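/- Let $M$ and $N$ be oriented smooth Riemannian $n$-manifolds (Hausdorff, second countable, without boundary, not necessarily connected), let $k \ge 0$ be an integer, $p,q\in[1,\infty]$ and $L>0$, with the convention $n/\infty=0$. For a measurable differential $k$-form $\omega$ let $|\omega_x|$ be the norm induced by the Grassmann inner product on $\wedge^k T_x^*M$, and let $\|\omega\|_p$ be the $L^p$-norm of $x\mapsto|\omega_x|$ with respect to the Riemannian measure; forms are identified if they agree almost everywhere. For locally integrable $\omega$, a locally integrable $(k+1)$-form $d\omega$ is a weak exterior derivative of $\omega$ if $$\int_M \omega\wedge d\eta=(-1)^{k+1}\int_M d\omega\wedge\eta$$ for all compactly supported smooth $(n-k-1)$-forms $\eta$. The space $W^{d,p,q}(\wedge^k M)$ (resp. $W^{d,p,q}_{\mathrm{loc}}(\wedge^k M)$) consists of all $\omega\in L^p$ (resp. $L^p_{\mathrm{loc}}$) having a weak exterior derivative $d\omega\in L^q$ (resp. $L^q_{\mathrm{loc}}$). Let $f\colon M\to N$ be a smooth map that is $L$-bilipschitz, either with respect to the Riemannian distances, $$L^{-1}d_M(x,y)\le d_N(f(x),f(y))\le L\,d_M(x,y)\quad\text{for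 all }x,y\in M$$ (points in different components having distance $\infty$), or infinitesimally, i.e. $f$ is injective and $L^{-1}|v|\le|Df(x)v|\le L|v|$ for all $x\in M$, $v\in T_xM$. Then the pull-back $f^*$ of forms respects equality almost everywhere, and the following hold. 1. If $\omega\in W^{d,p,q}_{\mathrm{loc}}(\wedge^k N)$, then $f^*\omega\in W^{d,p,q}_{\mathrm{loc}}(\wedge^k M)$ and $d f^*\omega=f^*d\omega$; that is, for every weak exterior derivative $d\omega$ of $\omega$, the form $f^*d\omega$ is a weak exterior derivative of $f^*\omega$. 2. If $\omega\in W^{d,p,q}(\wedge^k N)$, then $f^*\omega\in W^{d,p,q}(\wedge^k M)$, and $$\|f^*\omega\|_p\le\binom nk^{1/2}L^{k+\frac np}\|\omega\|_p,\qquad \|f^*d\omega\|_q\le\binom n{k+1}^{1/2}L^{k+1+\frac nq}\|d\omega\|_q .$$ -/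

import Mathlib

open scoped Manifold ContDiff ENNReal Topology
open MeasureTheory Module Bundle

noncomputable section

namespace SobolevForms

/-! ### Multilinear algebra on a Euclidean vector space -/

/-- The exterior product `α ∧ β` (sum over shuffles, so that
`(dx₁ ∧ ⋯ ∧ dxₖ)(e₁, …, eₖ) = 1`), read as a form of degree `n = k + l`. -/
def wedge {V : Type*} [AddCommGroup V] [Module ℝ V] {k l n : ℕ} (h : k + l = n)
    (α : V [⋀^Fin k]→ₗ[ℝ] ℝ) (β : V [⋀^Fin l]→ₗ[ℝ] ℝ) : V [⋀^Fin n]→ₗ[ℝ] ℝ :=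
  ((LinearMap.mul' ℝ ℝ).compAlternatingMap (α.domCoprod β)).domDomCongr
    (finSumFinEquiv.trans (finCongr h))

/-- The Grassmann norm of a `k`-covector `α`: the norm of `α` as a linear functional on the
exterior power `⋀ᵏ V` with its Grassmann inner product
`⟪v₁ ∧ ⋯ ∧ vₖ, w₁ ∧ ⋯ ∧ wₖ⟫ = det ⟪vᵢ, wⱼ⟫`; see `grassmannNorm_sq` for the coordinate
expression. -/
def grassmannNorm {V : Type*} [NormedAddCommGroup V] [InnerProductSpace ℝ V]
    [FiniteDimensional ℝ V] {k : ℕ} (α : V [⋀^Fin k]→ₗ[ℝ] ℝ) : ℝ :=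
  ‖LinearMap.toContinuousLinearMap (exteriorPower.alternatingMapLinearEquiv α)‖

/-- In every orthonormal basis, `|α|² = ∑_I α(e_{I₁}, …, e_{Iₖ})²`, where `I` runs through the
`k`-element subsets of the index set. -/
theorem grassmannNorm_sq {V : Type*} [NormedAddCommGroup V] [InnerProductSpace ℝ V]
    [FiniteDimensional ℝ V] {k : ℕ} {ι : Type*} [Fintype ι] [LinearOrder ι]
    (e : OrthonormalBasis ι ℝ V) (α : V [⋀^Fin k]→ₗ[ℝ] ℝ) :
    grassmannNorm α ^ 2 =
      ∑ I : Set.powersetCard ι k,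
        α (fun j => e (Set.powersetCard.ofFinEmbEquiv.symm I j)) ^ 2 := by
  set l := LinearMap.toContinuousLinearMap (exteriorPower.alternatingMapLinearEquiv α) with hl
  have h1 : ‖l‖ = ‖(InnerProductSpace.toDual ℝ (⋀[ℝ]^k V)).symm l‖ := by simp
  rw [grassmannNorm, ← hl, h1, ← (e.exteriorPower k).sum_sq_norm_inner_left]
  refine Finset.sum_congr rfl fun I _ => ?_
  rw [InnerProductSpace.toDual_symm_apply, Real.norm_eq_abs, sq_abs, hl,
    LinearMap.coe_toContinuousLinearMap', ← OrthonormalBasis.coe_toBasis,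
    OrthonormalBasis.toBasis_exteriorPower, exteriorPower.coe_basis, exteriorPower.ιMulti_family,
    exteriorPower.alternatingMapLinearEquiv_apply_ιMulti, OrthonormalBasis.coe_toBasis]
  rfl

/-- The coefficient `g` of a form `β = g • vol` of top degree on an oriented Euclidean space,
computed in some orthonormal basis; see `volCoeff_smul_volumeForm`. -/
def volCoeff {V : Type*} [NormedAddCommGroup V] [InnerProductSpace ℝ V] [FiniteDimensional ℝ V]
    {n : ℕ} [hV : Fact (finrank ℝ V = n)] (o : Orientation ℝ V (Fin n))
    (β : V [⋀^Fin n]→ₗ[ℝ] ℝ) : ℝ :=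
  β ((stdOrthonormalBasis ℝ V).reindex (finCongr hV.out)) /
    o.volumeForm ((stdOrthonormalBasis ℝ V).reindex (finCongr hV.out))

theorem volCoeff_smul_volumeForm {V : Type*} [NormedAddCommGroup V] [InnerProductSpace ℝ V]
    [FiniteDimensional ℝ V] {n : ℕ} [hV : Fact (finrank ℝ V = n)] (o : Orientation ℝ V (Fin n))
    (β : V [⋀^Fin n]→ₗ[ℝ] ℝ) : volCoeff o β • o.volumeForm = β := by
  set b := (stdOrthonormalBasis ℝ V).reindex (finCongr hV.out) with hb
  have h0 : o.volumeForm b ≠ 0 := by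
    have := o.abs_volumeForm_apply_of_orthonormal b
    intro h
    simp [h] at this
  have h1 : (volCoeff o β • o.volumeForm) b = β b := by
    simp only [AlternatingMap.smul_apply, smul_eq_mul, volCoeff, ← hb]
    field_simp
  refine (AlternatingMap.eq_smul_basis_det b.toBasis _).trans
    (Eq.trans ?_ (AlternatingMap.eq_smul_basis_det b.toBasis β).symm)
  rw [OrthonormalBasis.coe_toBasis, h1]

/-! ### Differential forms on smooth manifolds -/

section Manifold

variable {n : ℕ} {M : Type*} [TopologicalSpace M] [ChartedSpace (EuclideanSpace ℝ (Fin n)) M]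

instance fact_finrank_tangent (x : M) : Fact (finrank ℝ (TangentSpace (𝓡 n) x) = n) :=
  ⟨finrank_euclideanSpace_fin⟩

instance finiteDimensional_tangent (x : M) : FiniteDimensional ℝ (TangentSpace (𝓡 n) x) :=
  inferInstanceAs (FiniteDimensional ℝ (EuclideanSpace ℝ (Fin n)))

variable (n M) in
/-- Differential `k`-forms on the `n`-manifold `M`: arbitrary sections of `⋀ᵏ T*M`. -/
abbrev DiffForm (k : ℕ) : Type _ := (x : M) → (TangentSpace (𝓡 n) x) [⋀^Fin k]→L[ℝ] ℝ

/-- The pull-back `(f^* α)_x = α_{f(x)} ∘ ⋀ᵏ Df(x)`. -/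
def pullback {N : Type*} [TopologicalSpace N] [ChartedSpace (EuclideanSpace ℝ (Fin n)) N] {k : ℕ}
    (f : M → N) (α : DiffForm n N k) : DiffForm n M k :=
  fun x => (α (f x)).compContinuousLinearMap (mfderiv (𝓡 n) (𝓡 n) f x)

/-- The coordinate expression `(φ⁻¹)^* α` of `α` in the chart `φ`
(meaningful on `φ.target` only). -/
def inChart {k : ℕ} (φ : OpenPartialHomeomorph M (EuclideanSpace ℝ (Fin n))) (α : DiffForm n M k)
    (z : EuclideanSpace ℝ (Fin n)) : (EuclideanSpace ℝ (Fin n)) [⋀^Fin k]→L[ℝ] ℝ :=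
  (α (φ.symm z)).compContinuousLinearMap (mfderiv (𝓡 n) (𝓡 n) φ.symm z)

/-- A form is smooth if its coordinate expression in every smooth chart is. -/
def IsSmoothForm {k : ℕ} (η : DiffForm n M k) : Prop :=
  ∀ φ ∈ IsManifold.maximalAtlas (𝓡 n) ∞ M, ContDiffOn ℝ ∞ (inChart φ η) φ.target

/-- Smooth forms with compact support. -/
def IsTestForm {k : ℕ} (η : DiffForm n M k) : Prop :=
  IsSmoothForm η ∧ IsCompact (closure {x | η x ≠ 0})

/-- The exterior derivative of a smooth form, `dη = φ^* d((φ⁻¹)^* η)` at the point `x`, where `φ`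
is the preferred chart at `x`. -/
def extDerivForm {k : ℕ} (η : DiffForm n M k) : DiffForm n M (k + 1) := fun x =>
  (extDeriv (inChart (chartAt (EuclideanSpace ℝ (Fin n)) x) η)
    (chartAt (EuclideanSpace ℝ (Fin n)) x x)).compContinuousLinearMap
      (mfderiv (𝓡 n) (𝓡 n) (chartAt (EuclideanSpace ℝ (Fin n)) x) x)

/-- A form is (Lebesgue) measurable if all its coordinate functions in every smooth chart are
Lebesgue measurable. -/
def IsMeasurableForm {k : ℕ} (α : DiffForm n M k) : Prop :=
  ∀ φ ∈ IsManifold.maximalAtlas (𝓡 n) ∞ M, ∀ v : Fin k → EuclideanSpace ℝ (Fin n),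
    AEMeasurable (fun z => inChart φ α z v) (volume.restrict φ.target)

/-- The vector `∂_i` of the chart `φ` at the point `φ⁻¹(z)`. -/
def coordVector (φ : OpenPartialHomeomorph M (EuclideanSpace ℝ (Fin n)))
    (z : EuclideanSpace ℝ (Fin n)) (i : Fin n) : TangentSpace (𝓡 n) (φ.symm z) :=
  mfderiv (𝓡 n) (𝓡 n) φ.symm z (EuclideanSpace.single i (1 : ℝ))

/-! ### Orientations and the Riemannian measure -/

variable [RiemannianBundle (fun x : M => TangentSpace (𝓡 n) x)]

/-- The absolute value `|J_{φ⁻¹}|(z)` of the Jacobian of `φ⁻¹` with respect to the Riemannian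
metric, i.e. the square root of the determinant of the matrix `⟪∂_i, ∂_j⟫`. -/
def absJacobian (φ : OpenPartialHomeomorph M (EuclideanSpace ℝ (Fin n)))
    (z : EuclideanSpace ℝ (Fin n)) : ℝ :=
  √(Matrix.gram ℝ (coordVector φ z)).det

variable (n M) in
/-- An orientation of `M`: an orientation of every tangent space such that every point lies in the
domain of a smooth chart whose coordinate frame is positively oriented. -/
structure ManifoldOrientation where
  /-- The orientation of the tangent space at `x`. -/
  orient : ∀ x : M, Orientation ℝ (TangentSpace (𝓡 n) x) (Fin n)
  exists_chart : ∀ x : M, ∃ φ ∈ IsManifold.maximalAtlas (𝓡 n) ∞ M, x ∈ φ.source ∧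
    ∀ z ∈ φ.target, 0 < (orient (φ.symm z)).volumeForm (coordVector φ z)

variable [MeasurableSpace M]

/-- The measure `E ↦ ∫_{φ(E ∩ U)} |J_{φ⁻¹}|` on the domain `U` of the chart `φ`. -/
def chartMeasure (φ : OpenPartialHomeomorph M (EuclideanSpace ℝ (Fin n))) : Measure M :=
  ((volume.restrict φ.target).withDensity
    (fun z => ENNReal.ofReal (absJacobian φ z))).map φ.symm

variable (n M) in
/-- The Riemannian measure of `M`. On overlaps of charts the chart measures agree, so their least
upper bound is the unique measure (on a second countable `M`) that agrees with the chart measure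
on the domain of every smooth chart. -/
def riemannianMeasure : Measure M :=
  ⨆ φ ∈ IsManifold.maximalAtlas (𝓡 n) ∞ M, chartMeasure φ

/-- The norm `‖α‖_p`, `1 ≤ p ≤ ∞`, of the function `x ↦ |α_x|`, with values in `[0, ∞]`. -/
def formNorm {k : ℕ} (p : ℝ≥0∞) (α : DiffForm n M k) : ℝ≥0∞ :=
  eLpNorm (fun x => grassmannNorm (α x).toAlternatingMap) p (riemannianMeasure n M)

/-- `α ∈ L^p(⋀ᵏ M)`. -/
def MemLpForm {k : ℕ} (p : ℝ≥0∞) (α : DiffForm n M k) : Prop :=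
  IsMeasurableForm α ∧ formNorm p α < ⊤

/-- `α ∈ L^p_loc(⋀ᵏ M)`. -/
def MemLpLocForm {k : ℕ} (p : ℝ≥0∞) (α : DiffForm n M k) : Prop :=
  IsMeasurableForm α ∧ ∀ x : M, ∃ U ∈ 𝓝 x,
    eLpNorm (fun y => grassmannNorm (α y).toAlternatingMap) p
      ((riemannianMeasure n M).restrict U) < ⊤

/-! ### Integration of forms and the weak exterior derivative -/

/-- The integral `∫_M β = ∫_M g dm` of a form `β = g vol_M` of degree `n`. -/
def integralForm (o : ManifoldOrientation n M)
    (β : (x : M) → (TangentSpace (𝓡 n) x) [⋀^Fin n]→ₗ[ℝ] ℝ) : ℝ :=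
  ∫ x, volCoeff (o.orient x) (β x) ∂(riemannianMeasure n M)

/-- `τ` is a weak exterior derivative of the `k`-form `α`: both are locally integrable and
`∫_M α ∧ dη = (-1)^{k+1} ∫_M τ ∧ η` for all compactly supported smooth forms `η` of degree
`m = n - k - 1` (for `k ≥ n` there are none). -/
def IsWeakExtDeriv {k : ℕ} (o : ManifoldOrientation n M) (α : DiffForm n M k)
    (τ : DiffForm n M (k + 1)) : Prop :=
  MemLpLocForm 1 α ∧ MemLpLocForm 1 τ ∧
    ∀ (m : ℕ) (h : k + (m + 1) = n) (h' : k + 1 + m = n) (η : DiffForm n M m), IsTestForm η →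
      integralForm o
          (fun x => wedge h (α x).toAlternatingMap (extDerivForm η x).toAlternatingMap) =
        (-1) ^ (k + 1) *
          integralForm o (fun x => wedge h' (τ x).toAlternatingMap (η x).toAlternatingMap)

/-- `α ∈ W^{d,p,q}(⋀ᵏ M)`. -/
def MemW {k : ℕ} (o : ManifoldOrientation n M) (p q : ℝ≥0∞) (α : DiffForm n M k) : Prop :=
  MemLpForm p α ∧ ∃ τ : DiffForm n M (k + 1), IsWeakExtDeriv o α τ ∧ MemLpForm q τ

/-- `α ∈ W^{d,p,q}_loc(⋀ᵏ M)`. -/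
def MemWLoc {k : ℕ} (o : ManifoldOrientation n M) (p q : ℝ≥0∞) (α : DiffForm n M k) : Prop :=
  MemLpLocForm p α ∧ ∃ τ : DiffForm n M (k + 1), IsWeakExtDeriv o α τ ∧ MemLpLocForm q τ

end Manifold

/-! ### Bilipschitz maps -/

section Bilipschitz

variable {n : ℕ}
  {M : Type*} [TopologicalSpace M] [ChartedSpace (EuclideanSpace ℝ (Fin n)) M]
  [RiemannianBundle (fun x : M => TangentSpace (𝓡 n) x)]
  {N : Type*} [TopologicalSpace N] [ChartedSpace (EuclideanSpace ℝ (Fin n)) N]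
  [RiemannianBundle (fun y : N => TangentSpace (𝓡 n) y)]

variable (n) in
/-- `f` is `L`-bilipschitz for the Riemannian distances (infima of lengths of `C¹` paths, with
value `∞` for points of different components). -/
def IsBilipschitz (L : ℝ) (f : M → N) : Prop :=
  ∀ x y : M,
    ENNReal.ofReal L⁻¹ * Manifold.riemannianEDist (𝓡 n) x y ≤
        Manifold.riemannianEDist (𝓡 n) (f x) (f y) ∧
      Manifold.riemannianEDist (𝓡 n) (f x) (f y) ≤
        ENNReal.ofReal L * Manifold.riemannianEDist (𝓡 n) x y

variable (n) in
/-- `f` is infinitesimally `L`-bilipschitz: it is injective and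
`L⁻¹ |v| ≤ |Df(x) v| ≤ L |v|` for all tangent vectors `v`. -/
def IsInfinitesimallyBilipschitz (L : ℝ) (f : M → N) : Prop :=
  Function.Injective f ∧ ∀ (x : M) (v : TangentSpace (𝓡 n) x),
    L⁻¹ * ‖v‖ ≤ ‖mfderiv (𝓡 n) (𝓡 n) f x v‖ ∧ ‖mfderiv (𝓡 n) (𝓡 n) f x v‖ ≤ L * ‖v‖

end Bilipschitz

end SobolevForms

end

open SobolevForms

noncomputable section

namespace SobolevForms

/-! ### Gram determinants and Hadamard's inequality -/

section LinearAlgebra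

variable {V : Type*} [NormedAddCommGroup V] [InnerProductSpace ℝ V]
  {W : Type*} [NormedAddCommGroup W] [InnerProductSpace ℝ W]

/-! No approximation by smooth forms is needed: the map turns out to be a diffeomorphism onto an
open subset of `N`, and everything follows from change of variables and from transporting test
forms.

A bilipschitz bound for the distances implies the infinitesimal one
(`IsBilipschitz.isInfinitesimallyBilipschitz`), because near a point the Riemannian distance is the
norm of the tangent space at that point, read in a chart, up to a factor arbitrarily close to 1. The
lower bound for the derivative makes it injective, hence invertible since the dimensions agree. With
the injectivity of the map, the inverse function theorem yields the diffeomorphism onto an open set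
(`exists_isPartialDiffeo`).

The norm estimates combine two pointwise facts. In an orthonormal basis a pulled back `k`-covector
has `n.choose k` coefficients, each at most `L ^ k` times the Grassmann norm of the original one, by
Hadamard's inequality (`grassmannNorm_compLinearMap_le`). The Jacobian is at least `L⁻ⁿ`
(`one_le_pow_mul_jac`), so the image of the measure of `M` is at most `L ^ n` times that of `N`
(`map_riemannianMeasure_le`); this gives the factor `L ^ (n / p)` and also the compatibility with
equality almost everywhere.

For the weak derivative, a test form on `M` is pushed forward to `N`, extended by zero and
multiplied by the sign of the Jacobian determinant. The sign is locally constant, so it commutes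
with `d`, and the image of the support is compact, hence closed in the Hausdorff space `N`, so the
result is again a test form (`isTestForm_signedPushforward`). The sign turns the signed Jacobian of
the wedge product into the density of the measure, so both integrals transform correctly without `f`
preserving orientations (`integralForm_wedge_pullback`). The defining identity on `N`, tested with
this form, is then the required identity on `M`. -/

/-- The square root of the Gram determinant is the absolute value of the determinant with respect
to an orthonormal basis. -/
theorem sqrt_det_gram {ι : Type*} [Fintype ι] [DecidableEq ι] (b : OrthonormalBasis ι ℝ V)
    (v : ι → V) : √(Matrix.gram ℝ v).det = |b.toBasis.det v| := by
  rw [Matrix.gram_eq_conjTranspose_mul b v, Matrix.det_mul, Matrix.det_conjTranspose, star_trivial,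
    ← pow_two, Real.sqrt_sq_eq_abs, Basis.det_apply]
  congr 2

/-- Hadamard's inequality for the determinant with respect to an orthonormal basis. -/
theorem abs_det_le_prod_norm {n : ℕ} (b : OrthonormalBasis (Fin n) ℝ V) (v : Fin n → V) :
    |b.toBasis.det v| ≤ ∏ i, ‖v i‖ := by
  have : Fact (finrank ℝ V = n) := ⟨by simpa using finrank_eq_card_basis b.toBasis⟩
  rw [← b.toBasis.orientation.volumeForm_robust b rfl]
  exact b.toBasis.orientation.abs_volumeForm_apply_le v

/-- Hadamard's inequality for Gram determinants. -/
theorem sqrt_det_gram_le_prod_norm {k : ℕ} (v : Fin k → V) :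
    √(Matrix.gram ℝ v).det ≤ ∏ i, ‖v i‖ := by
  -- Independent vectors span a space of dimension `k`, in which the Gram determinant is the square
  -- of a determinant; for dependent vectors it vanishes.
  by_cases hv : LinearIndependent ℝ v
  · have : FiniteDimensional ℝ (Submodule.span ℝ (Set.range v)) :=
      FiniteDimensional.span_of_finite ℝ (Set.finite_range v)
    have hk : finrank ℝ (Submodule.span ℝ (Set.range v)) = k := by
      simpa using finrank_span_eq_card hv
    let b := (stdOrthonormalBasis ℝ (Submodule.span ℝ (Set.range v))).reindex (finCongr hk)
    let w : Fin k → Submodule.span ℝ (Set.range v) :=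
      fun i => ⟨v i, Submodule.subset_span ⟨i, rfl⟩⟩
    have hw : Matrix.gram ℝ v = Matrix.gram ℝ w := rfl
    rw [hw, sqrt_det_gram b]
    exact abs_det_le_prod_norm b w
  · have h0 : (Matrix.gram ℝ v).det = 0 := by
      by_contra h
      exact hv (Matrix.linearIndependent_of_det_gram_ne_zero h)
    rw [h0, Real.sqrt_zero]
    positivity

variable [FiniteDimensional ℝ V] [FiniteDimensional ℝ W]

/-- The Grassmann norm is an operator norm on the exterior power, and the decomposable vector `v₁ ∧
⋯ ∧ vₖ` has norm equal to the root of the Gram determinant, which Hadamard's inequality bounds. -/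
theorem abs_apply_le_grassmannNorm {k : ℕ} (α : V [⋀^Fin k]→ₗ[ℝ] ℝ) (v : Fin k → V) :
    |α v| ≤ grassmannNorm α * ∏ i, ‖v i‖ := by
  have h1 : α v = LinearMap.toContinuousLinearMap (exteriorPower.alternatingMapLinearEquiv α)
      (exteriorPower.ιMulti ℝ k v) := by
    rw [LinearMap.coe_toContinuousLinearMap',
      exteriorPower.alternatingMapLinearEquiv_apply_ιMulti]
  rw [h1, ← Real.norm_eq_abs]
  refine (ContinuousLinearMap.le_opNorm _ _).trans ?_
  refine mul_le_mul_of_nonneg_left ?_ (norm_nonneg _)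
  rw [norm_eq_sqrt_real_inner, exteriorPower.inner_ιMulti_self]
  exact sqrt_det_gram_le_prod_norm v

theorem grassmannNorm_nonneg {k : ℕ} (α : V [⋀^Fin k]→ₗ[ℝ] ℝ) : 0 ≤ grassmannNorm α :=
  norm_nonneg (LinearMap.toContinuousLinearMap (exteriorPower.alternatingMapLinearEquiv α))

/-- A linear map with norm at most `L` increases the Grassmann norm of `k`-covectors by at most the
factor `(n choose k)^{1/2} L^k`. -/
theorem grassmannNorm_compLinearMap_le {n k : ℕ} (hn : finrank ℝ V = n) {L : ℝ} (hL : 0 ≤ L)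
    (A : V →ₗ[ℝ] W) (hA : ∀ v, ‖A v‖ ≤ L * ‖v‖) (α : W [⋀^Fin k]→ₗ[ℝ] ℝ) :
    grassmannNorm (α.compLinearMap A) ≤ √(n.choose k : ℝ) * L ^ k * grassmannNorm α := by
  refine abs_le_of_sq_le_sq' ?_ (by have := grassmannNorm_nonneg α; positivity) |>.2
  let e := (stdOrthonormalBasis ℝ V).reindex (finCongr hn)
  rw [grassmannNorm_sq e, mul_pow, mul_pow, Real.sq_sqrt (by positivity), mul_assoc]
  -- Each coefficient is `α` evaluated on the images of `k` unit vectors, all of length at most `L`;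
  -- the binomial coefficient then counts the index sets.
  have hb : ∀ I : Set.powersetCard (Fin n) k, (α.compLinearMap A)
      (fun j => e (Set.powersetCard.ofFinEmbEquiv.symm I j)) ^ 2 ≤
      (L ^ k) ^ 2 * grassmannNorm α ^ 2 := by
    intro I
    rw [← mul_pow, ← sq_abs]
    refine pow_le_pow_left₀ (abs_nonneg _) ?_ 2
    rw [AlternatingMap.compLinearMap_apply]
    refine (abs_apply_le_grassmannNorm _ _).trans ?_
    rw [mul_comm]
    refine mul_le_mul_of_nonneg_right ?_ (grassmannNorm_nonneg _)
    calc ∏ i, ‖A (e (Set.powersetCard.ofFinEmbEquiv.symm I i))‖ ≤ ∏ _i : Fin k, L :=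
          Finset.prod_le_prod (fun _ _ => norm_nonneg _) fun i _ => by simpa using hA (e _)
      _ = L ^ k := by simp
  refine (Finset.sum_le_sum fun I _ => hb I).trans (le_of_eq ?_)
  rw [Finset.sum_const, nsmul_eq_mul, Finset.card_univ, ← Nat.card_eq_fintype_card,
    Set.powersetCard.card, Nat.card_eq_fintype_card, Fintype.card_fin]

/-! ### The Jacobian of a linear map -/

/-- The absolute value of the Jacobian determinant of a linear map between Euclidean spaces of the
same dimension. -/
def jac (A : V →ₗ[ℝ] W) : ℝ :=
  √(Matrix.gram ℝ (fun i => A (stdOrthonormalBasis ℝ V i))).det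

omit [FiniteDimensional ℝ W] in
theorem jac_nonneg (A : V →ₗ[ℝ] W) : 0 ≤ jac A := Real.sqrt_nonneg _

omit [FiniteDimensional ℝ W] in
theorem jac_eq {n : ℕ} (A : V →ₗ[ℝ] W) (b : OrthonormalBasis (Fin n) ℝ V)
    (c : OrthonormalBasis (Fin n) ℝ W) : jac A = |c.toBasis.det (A ∘ b)| := by
  have hn : finrank ℝ V = n := by simpa using finrank_eq_card_basis b.toBasis
  subst hn
  rw [jac, sqrt_det_gram c]
  change |c.toBasis.det (A ∘ (stdOrthonormalBasis ℝ V))| = _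
  have h := congrArg (fun f : V [⋀^Fin _]→ₗ[ℝ] ℝ => f (stdOrthonormalBasis ℝ V))
    ((c.toBasis.det.compLinearMap A).eq_smul_basis_det b.toBasis)
  simp only [AlternatingMap.compLinearMap_apply, AlternatingMap.smul_apply, smul_eq_mul,
    OrthonormalBasis.coe_toBasis] at h
  rw [show (A ∘ (stdOrthonormalBasis ℝ V) : _ → W) = fun i => A (stdOrthonormalBasis ℝ V i) from rfl,
    h, abs_mul, ← sqrt_det_gram b,
    Matrix.gram_eq_one_iff_orthonormal.2 (stdOrthonormalBasis ℝ V).orthonormal, Matrix.det_one,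
    Real.sqrt_one, mul_one]
  rfl

/-- Alternating forms of top degree are multiples of one another, so the determinant of `W` pulled
back by `A` is a constant times the determinant of `V`. All later transformation rules for volumes
come from this one. -/
theorem sqrt_det_gram_map {n : ℕ} (hV : finrank ℝ V = n) (hW : finrank ℝ W = n) (A : V →ₗ[ℝ] W)
    (v : Fin n → V) :
    √(Matrix.gram ℝ (fun i => A (v i))).det = jac A * √(Matrix.gram ℝ v).det := by
  let b := (stdOrthonormalBasis ℝ V).reindex (finCongr hV)
  let c := (stdOrthonormalBasis ℝ W).reindex (finCongr hW)
  rw [sqrt_det_gram c, sqrt_det_gram b, jac_eq A b c, ← abs_mul]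
  have h := congrArg (fun f : V [⋀^Fin _]→ₗ[ℝ] ℝ => f v)
    ((c.toBasis.det.compLinearMap A).eq_smul_basis_det b.toBasis)
  simp only [AlternatingMap.compLinearMap_apply, AlternatingMap.smul_apply, smul_eq_mul,
    OrthonormalBasis.coe_toBasis] at h
  rw [h]
  rfl

/-- A linear map that contracts lengths by at most `L⁻¹` contracts volumes by at most `L⁻ⁿ`. -/
theorem one_le_pow_mul_jac {n : ℕ} (hV : finrank ℝ V = n) (hW : finrank ℝ W = n) (A : V →ₗ[ℝ] W)
    {L : ℝ} (hL : 0 < L) (hA : ∀ v, L⁻¹ * ‖v‖ ≤ ‖A v‖) : 1 ≤ L ^ n * jac A := by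
  have hinj : Function.Injective A := by
    refine (injective_iff_map_eq_zero A).2 fun v hv => ?_
    have := hA v
    rw [hv, norm_zero] at this
    have hv' : ‖v‖ ≤ 0 := by
      by_contra! h
      have : 0 < L⁻¹ * ‖v‖ := by positivity
      linarith
    simpa using hv'
  let b := (stdOrthonormalBasis ℝ V).reindex (finCongr hV)
  let c := (stdOrthonormalBasis ℝ W).reindex (finCongr hW)
  have hsurj : Function.Surjective A :=
    (LinearMap.injective_iff_surjective_of_finrank_eq_finrank (hV.trans hW.symm)).1 hinj
  -- The vectors `v i` are preimages of an orthonormal basis: their images span volume 1, while they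
  -- have length at most `L` and so span volume at most `L ^ n`.
  choose v hv using fun i => hsurj (c i)
  have h1 := sqrt_det_gram_map hV hW A v
  have h2 : √(Matrix.gram ℝ (fun i => A (v i))).det = 1 := by
    simp_rw [hv]
    rw [Matrix.gram_eq_one_iff_orthonormal.2 c.orthonormal, Matrix.det_one, Real.sqrt_one]
  have h3 : √(Matrix.gram ℝ v).det ≤ L ^ n := by
    refine (sqrt_det_gram_le_prod_norm v).trans ?_
    calc ∏ i, ‖v i‖ ≤ ∏ _i : Fin n, L :=
          Finset.prod_le_prod (fun _ _ => norm_nonneg _) fun i _ => by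
            have := hA (v i)
            rw [hv, c.orthonormal.1 i] at this
            rwa [inv_mul_le_iff₀ hL, mul_one] at this
      _ = L ^ n := by simp
  rw [h2] at h1
  rw [h1, mul_comm (L ^ n)]
  exact mul_le_mul_of_nonneg_left h3 (jac_nonneg A)

/-! ### Top degree forms -/

section Top

variable {n : ℕ} [hV : Fact (finrank ℝ V = n)] [hW : Fact (finrank ℝ W = n)]

theorem volCoeff_smul (o : Orientation ℝ V (Fin n)) (c : ℝ) (β : V [⋀^Fin n]→ₗ[ℝ] ℝ) :
    volCoeff o (c • β) = c * volCoeff o β := by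
  simp only [volCoeff, AlternatingMap.smul_apply, smul_eq_mul, mul_div_assoc]

theorem volCoeff_zero (o : Orientation ℝ V (Fin n)) :
    volCoeff o (0 : V [⋀^Fin n]→ₗ[ℝ] ℝ) = 0 := by
  simp [volCoeff]

theorem volCoeff_mul_volumeForm (o : Orientation ℝ V (Fin n)) (β : V [⋀^Fin n]→ₗ[ℝ] ℝ)
    (v : Fin n → V) : volCoeff o β * o.volumeForm v = β v := by
  have h := congrArg (fun f : V [⋀^Fin n]→ₗ[ℝ] ℝ => f v) (volCoeff_smul_volumeForm o β)
  simpa using h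

/-- The signed Jacobian determinant of a linear map between oriented Euclidean spaces. -/
def signedJac (o : Orientation ℝ V (Fin n)) (o' : Orientation ℝ W (Fin n)) (A : V →ₗ[ℝ] W) : ℝ :=
  volCoeff o (o'.volumeForm.compLinearMap A)

theorem volCoeff_compLinearMap (o : Orientation ℝ V (Fin n)) (o' : Orientation ℝ W (Fin n))
    (A : V →ₗ[ℝ] W) (β : W [⋀^Fin n]→ₗ[ℝ] ℝ) :
    volCoeff o (β.compLinearMap A) = volCoeff o' β * signedJac o o' A := by
  have h : β.compLinearMap A = volCoeff o' β • o'.volumeForm.compLinearMap A := by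
    conv_lhs => rw [← volCoeff_smul_volumeForm o' β]
    rfl
  rw [h, volCoeff_smul, signedJac]

omit [FiniteDimensional ℝ W] in
theorem signedJac_mul_volumeForm (o : Orientation ℝ V (Fin n)) (o' : Orientation ℝ W (Fin n))
    (A : V →ₗ[ℝ] W) (v : Fin n → V) :
    signedJac o o' A * o.volumeForm v = o'.volumeForm (fun i => A (v i)) :=
  volCoeff_mul_volumeForm o _ v

theorem abs_volumeForm_apply (o : Orientation ℝ V (Fin n)) (v : Fin n → V) :
    |o.volumeForm v| = √(Matrix.gram ℝ v).det := by
  let b := (stdOrthonormalBasis ℝ V).reindex (finCongr hV.out)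
  rw [o.volumeForm_robust' b, sqrt_det_gram b]

theorem abs_signedJac (o : Orientation ℝ V (Fin n)) (o' : Orientation ℝ W (Fin n))
    (A : V →ₗ[ℝ] W) : |signedJac o o' A| = jac A := by
  let b := (stdOrthonormalBasis ℝ V).reindex (finCongr hV.out)
  have h := congrArg abs (signedJac_mul_volumeForm o o' A b)
  rwa [abs_mul, o.abs_volumeForm_apply_of_orthonormal, mul_one, abs_volumeForm_apply,
    sqrt_det_gram_map hV.out hW.out, Matrix.gram_eq_one_iff_orthonormal.2 b.orthonormal,
    Matrix.det_one, Real.sqrt_one, mul_one] at h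

end Top

/-! ### The exterior product -/

section Wedge

variable {k l n : ℕ} (h : k + l = n) (α : W [⋀^Fin k]→ₗ[ℝ] ℝ) (β : W [⋀^Fin l]→ₗ[ℝ] ℝ)

omit [FiniteDimensional ℝ V] [FiniteDimensional ℝ W] in
theorem wedge_compLinearMap (A : V →ₗ[ℝ] W) :
    wedge h (α.compLinearMap A) (β.compLinearMap A) = (wedge h α β).compLinearMap A := by
  ext v
  simp only [wedge, AlternatingMap.domDomCongr_apply, LinearMap.compAlternatingMap_apply,
    AlternatingMap.compLinearMap_apply, AlternatingMap.domCoprod_apply, sum_apply]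
  congr 1
  refine Finset.sum_congr rfl fun σ _ => ?_
  induction σ using Quotient.inductionOn'
  rfl

omit [FiniteDimensional ℝ W] in
theorem wedge_smul_right (c : ℝ) : wedge h α (c • β) = c • wedge h α β := by
  rw [wedge, wedge, ← AlternatingMap.domCoprod'_apply, ← AlternatingMap.domCoprod'_apply,
    TensorProduct.tmul_smul, map_smul]
  ext v
  simp

omit [FiniteDimensional ℝ W] in
theorem wedge_zero_right : wedge h α 0 = 0 := by
  simpa using wedge_smul_right h α 0 0

end Wedge

end LinearAlgebra

end SobolevForms

end

noncomputable section

namespace SobolevForms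

open Set Filter Manifold

/-! ### Comparison of the Riemannian distance with the distance in a chart -/

section Distance

variable {n : ℕ} {M : Type*} [TopologicalSpace M] [ChartedSpace (EuclideanSpace ℝ (Fin n)) M]
  [IsManifold (𝓡 n) ∞ M] [RiemannianBundle (fun x : M => TangentSpace (𝓡 n) x)]

omit [RiemannianBundle (fun x : M => TangentSpace (𝓡 n) x)] in
theorem continuousLinearMapAt_eq_mfderiv_chartAt {x y : M}
    (hy : y ∈ (chartAt (EuclideanSpace ℝ (Fin n)) x).source) :
    (trivializationAt (EuclideanSpace ℝ (Fin n)) (TangentSpace (𝓡 n)) x).continuousLinearMapAt ℝ y =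
      mfderiv (𝓡 n) (𝓡 n) (chartAt (EuclideanSpace ℝ (Fin n)) x) y :=
  TangentBundle.continuousLinearMapAt_trivializationAt hy

omit [RiemannianBundle (fun x : M => TangentSpace (𝓡 n) x)] in
theorem symmL_eq_mfderiv_chartAt_symm {x y : M}
    (hy : y ∈ (chartAt (EuclideanSpace ℝ (Fin n)) x).source) :
    (trivializationAt (EuclideanSpace ℝ (Fin n)) (TangentSpace (𝓡 n)) x).symmL ℝ y =
      mfderiv (𝓡 n) (𝓡 n) (chartAt (EuclideanSpace ℝ (Fin n)) x).symm
        (chartAt (EuclideanSpace ℝ (Fin n)) x y) := by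
  rw [TangentBundle.symmL_trivializationAt hy, ← mfderivWithin_univ]
  congr 1
  simp

omit [RiemannianBundle (fun x : M => TangentSpace (𝓡 n) x)] in
theorem symmL_apply_eq_mfderiv_chartAt_symm {x : M} {z : EuclideanSpace ℝ (Fin n)}
    (hz : z ∈ (chartAt (EuclideanSpace ℝ (Fin n)) x).target) (w : EuclideanSpace ℝ (Fin n)) :
    (trivializationAt (EuclideanSpace ℝ (Fin n)) (TangentSpace (𝓡 n)) x).symmL ℝ
        ((chartAt (EuclideanSpace ℝ (Fin n)) x).symm z) w =
      mfderiv (𝓡 n) (𝓡 n) (chartAt (EuclideanSpace ℝ (Fin n)) x).symm z w := by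
  set φ := chartAt (EuclideanSpace ℝ (Fin n)) x
  -- The coordinate point is generalised so that it can be replaced by `φ (φ.symm z)` without
  -- rewriting inside a dependent type.
  have h1 : ∀ z', φ (φ.symm z) = z' →
      (trivializationAt (EuclideanSpace ℝ (Fin n)) (TangentSpace (𝓡 n)) x).symmL ℝ (φ.symm z) w =
        mfderiv (𝓡 n) (𝓡 n) φ.symm z' w := by
    rintro _ rfl
    exact congrArg (fun A : EuclideanSpace ℝ (Fin n) →L[ℝ] EuclideanSpace ℝ (Fin n) => A w)
      (symmL_eq_mfderiv_chartAt_symm (φ.map_target hz))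
  exact h1 z (φ.right_inv hz)

/-- A path is at least as long as its image in a chart, up to the norm of the derivative. -/
theorem enorm_sub_le_mul_pathELength {V : Type*} [NormedAddCommGroup V] [NormedSpace ℝ V]
    [CompleteSpace V]
    (x : M) (A : EuclideanSpace ℝ (Fin n) →L[ℝ] V) {r : ℝ} (hr : 0 ≤ r) {u : Set M}
    (hu : u ⊆ (chartAt (EuclideanSpace ℝ (Fin n)) x).source)
    (hA : ∀ y ∈ u, ∀ w : TangentSpace (𝓡 n) y,
      ‖A (mfderiv (𝓡 n) (𝓡 n) (chartAt (EuclideanSpace ℝ (Fin n)) x) y w)‖ ≤ r * ‖w‖)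
    {γ : ℝ → M} (hγ : ContMDiffOn 𝓘(ℝ, ℝ) (𝓡 n) 1 γ (Icc 0 1)) (hγu : MapsTo γ (Icc 0 1) u) :
    ‖A (chartAt (EuclideanSpace ℝ (Fin n)) x (γ 1) - chartAt (EuclideanSpace ℝ (Fin n)) x (γ 0))‖ₑ ≤
      ENNReal.ofReal r * pathELength (𝓡 n) γ 0 1 := by
  set φ := chartAt (EuclideanSpace ℝ (Fin n)) x with hφ
  have hφ1 : ContMDiffOn (𝓡 n) (𝓡 n) 1 φ φ.source :=
    contMDiffOn_chart
  have h1 : ContMDiffOn 𝓘(ℝ, ℝ) (𝓡 n) 1 (φ ∘ γ) (Icc 0 1) :=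
    hφ1.comp hγ fun t ht => hu (hγu ht)
  have h2 : ContDiffOn ℝ 1 (φ ∘ γ) (Icc 0 1) := contMDiffOn_iff_contDiffOn.1 h1
  have h3 : ContDiffOn ℝ 1 (A ∘ (φ ∘ γ)) (Icc 0 1) := A.contDiff.comp_contDiffOn h2
  rw [map_sub]
  refine (enorm_sub_le_lintegral_derivWithin_Icc_of_contDiffOn_Icc h3 zero_le_one).trans ?_
  rw [pathELength_eq_lintegral_mfderivWithin_Icc, ← lintegral_const_mul' _ _ ENNReal.ofReal_ne_top]
  refine setLIntegral_mono' measurableSet_Icc fun t ht => ?_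
  have hud : UniqueDiffWithinAt ℝ (Icc (0 : ℝ) 1) t := uniqueDiffOn_Icc zero_lt_one t ht
  have h4 : derivWithin (A ∘ (φ ∘ γ)) (Icc 0 1) t = A (derivWithin (φ ∘ γ) (Icc 0 1) t) := by
    have := (h2.differentiableOn one_ne_zero t ht).hasDerivWithinAt
    exact (A.hasFDerivAt.comp_hasDerivWithinAt t this).derivWithin hud
  have h5 : mfderivWithin 𝓘(ℝ, ℝ) (𝓡 n) (φ ∘ γ) (Icc 0 1) t =
      (mfderiv (𝓡 n) (𝓡 n) φ (γ t)).comp (mfderivWithin 𝓘(ℝ, ℝ) (𝓡 n) γ (Icc 0 1) t) := by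
    apply mfderiv_comp_mfderivWithin
    · exact ((hφ1 _ (hu (hγu ht))).contMDiffAt (φ.open_source.mem_nhds (hu (hγu ht)))).mdifferentiableAt
        one_ne_zero
    · exact hγ.mdifferentiableOn one_ne_zero _ ht
    · rwa [uniqueMDiffWithinAt_iff_uniqueDiffWithinAt]
  have h6 : derivWithin (φ ∘ γ) (Icc 0 1) t =
      mfderiv (𝓡 n) (𝓡 n) φ (γ t) (mfderivWithin 𝓘(ℝ, ℝ) (𝓡 n) γ (Icc 0 1) t 1) := by
    rw [← fderivWithin_derivWithin, ← mfderivWithin_eq_fderivWithin]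
    exact congr($h5 1)
  rw [h4, h6]
  rw [← ofReal_norm, ← ofReal_norm, ← ENNReal.ofReal_mul hr]
  exact ENNReal.ofReal_le_ofReal (hA _ (hγu ht) _)

variable [IsContMDiffRiemannianBundle (𝓡 n) ∞ (EuclideanSpace ℝ (Fin n))
      (fun x : M => TangentSpace (𝓡 n) x)]

theorem isContinuousRiemannianBundle_tangent :
    IsContinuousRiemannianBundle (EuclideanSpace ℝ (Fin n)) (fun x : M => TangentSpace (𝓡 n) x) := by
  obtain ⟨g, hg, h⟩ := IsContMDiffRiemannianBundle.exists_contMDiff (IB := 𝓡 n) (n := ∞)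
    (F := EuclideanSpace ℝ (Fin n)) (E := fun x : M => TangentSpace (𝓡 n) x)
  exact ⟨g, hg.continuous, h⟩

/-- Lower bound for the Riemannian distance near `x`, in terms of the metric at `x`. -/
theorem eventually_enorm_chartAt_sub_le [RegularSpace M] (x : M) {r : ℝ} (hr : 1 < r) :
    ∀ᶠ y in 𝓝 x, ‖(trivializationAt (EuclideanSpace ℝ (Fin n)) (TangentSpace (𝓡 n)) x).symmL ℝ x
        (chartAt (EuclideanSpace ℝ (Fin n)) x y - chartAt (EuclideanSpace ℝ (Fin n)) x x)‖ₑ ≤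
      ENNReal.ofReal r * riemannianEDist (𝓡 n) x y := by
  have := isContinuousRiemannianBundle_tangent (n := n) (M := M)
  set A := (trivializationAt (EuclideanSpace ℝ (Fin n)) (TangentSpace (𝓡 n)) x).symmL ℝ x with hA
  -- On `u` the metric at `y`, transported by the chart, differs from the metric at `x` by a factor
  -- of at most `r`; continuity of the metric makes `u` a neighbourhood.
  let u : Set M := {y | y ∈ (chartAt (EuclideanSpace ℝ (Fin n)) x).source ∧
    ∀ w : TangentSpace (𝓡 n) y,
      ‖A (mfderiv (𝓡 n) (𝓡 n) (chartAt (EuclideanSpace ℝ (Fin n)) x) y w)‖ ≤ r * ‖w‖}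
  have hu : u ∈ 𝓝 x := by
    filter_upwards [eventually_norm_symmL_trivializationAt_self_comp_lt (EuclideanSpace ℝ (Fin n))
      (fun x : M => TangentSpace (𝓡 n) x) x hr,
      chart_source_mem_nhds (EuclideanSpace ℝ (Fin n)) x] with y hy hy'
    refine ⟨hy', fun w => ?_⟩
    rw [← continuousLinearMapAt_eq_mfderiv_chartAt hy']
    exact ContinuousLinearMap.le_of_opNorm_le _ hy.le w
  obtain ⟨c, hc, hcu⟩ := setOfPred_riemannianEDist_lt_subset_nhds' (𝓡 n) hu
  filter_upwards [eventually_riemannianEDist_lt (𝓡 n) x hc] with y hy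
  have hfd : FiniteDimensional ℝ (TangentSpace (𝓡 n) x) := inferInstance
  have hcs : CompleteSpace (TangentSpace (𝓡 n) x) := FiniteDimensional.complete ℝ _
  have key : ∀ ρ, riemannianEDist (𝓡 n) x y < ρ → ρ ≤ c →
      ‖A (chartAt (EuclideanSpace ℝ (Fin n)) x y - chartAt (EuclideanSpace ℝ (Fin n)) x x)‖ₑ ≤
      ENNReal.ofReal r * ρ := by
    intro ρ hρ hρc
    obtain ⟨γ, h0, h1, hγ, hlen⟩ := exists_lt_of_riemannianEDist_lt hρ
    -- A path from `x` of length less than `c` cannot leave the ball of radius `c`, hence stays in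
    -- `u`, where the metrics are comparable.
    have hmaps : MapsTo γ (Icc 0 1) u := by
      intro t ht
      refine hcu ?_
      have h2 : riemannianEDist (𝓡 n) x (γ t) ≤ pathELength (𝓡 n) γ 0 t :=
        riemannianEDist_le_pathELength (hγ.mono (Icc_subset_Icc le_rfl ht.2)) h0 rfl ht.1
      exact (h2.trans (pathELength_mono le_rfl ht.2)).trans_lt (hlen.trans_le hρc)
    have h3 := enorm_sub_le_mul_pathELength x A (zero_le_one.trans hr.le) (fun y hy => hy.1)
      (fun y hy => hy.2) hγ hmaps
    rw [h0, h1] at h3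
    exact h3.trans (by gcongr)
  have hr0 : ENNReal.ofReal r ≠ 0 := by simpa using by linarith
  refine (ENNReal.div_le_iff' hr0 ENNReal.ofReal_ne_top).1 ?_
  -- `key` is available only for lengths up to `c`, hence the minimum of `ρ` and `c` below.
  refine le_of_forall_gt_imp_ge_of_dense fun ρ hρ => ?_
  refine (ENNReal.div_le_iff' hr0 ENNReal.ofReal_ne_top).2 ?_
  exact (key (min ρ c) (lt_min hρ hy) (min_le_right _ _)).trans
    (mul_le_mul_right (min_le_left _ _) _)

/-- Upper bound for the Riemannian distance near `x`, in terms of the metric at `x`. -/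
theorem eventually_riemannianEDist_le_enorm_chartAt_sub (x : M) {r : ℝ} (hr : 1 < r) :
    ∀ᶠ y in 𝓝 x, riemannianEDist (𝓡 n) x y ≤ ENNReal.ofReal r *
      ‖(trivializationAt (EuclideanSpace ℝ (Fin n)) (TangentSpace (𝓡 n)) x).symmL ℝ x
        (chartAt (EuclideanSpace ℝ (Fin n)) x y - chartAt (EuclideanSpace ℝ (Fin n)) x x)‖ₑ := by
  have := isContinuousRiemannianBundle_tangent (n := n) (M := M)
  have hr0 : 0 ≤ r := zero_le_one.trans hr.le
  set T := trivializationAt (EuclideanSpace ℝ (Fin n)) (TangentSpace (𝓡 n)) x with hT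
  set A := T.symmL ℝ x with hA
  set φ := chartAt (EuclideanSpace ℝ (Fin n)) x with hφ
  have hxφ : x ∈ φ.source := mem_chart_source _ x
  let u : Set M := {y | y ∈ φ.source ∧
    ∀ w : EuclideanSpace ℝ (Fin n), ‖T.symmL ℝ y w‖ ≤ r * ‖A w‖}
  have hTx : ∀ w, T.continuousLinearMapAt ℝ x (A w) = w := fun w =>
    T.continuousLinearMapAt_symmL (FiberBundle.mem_baseSet_trivializationAt' x) w
  have hu : u ∈ 𝓝 x := by
    filter_upwards [eventually_norm_symmL_trivializationAt_comp_self_lt (EuclideanSpace ℝ (Fin n))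
      (fun x : M => TangentSpace (𝓡 n) x) x hr,
      chart_source_mem_nhds (EuclideanSpace ℝ (Fin n)) x] with y hy hy'
    refine ⟨hy', fun w => ?_⟩
    have := ContinuousLinearMap.le_of_opNorm_le _ hy.le (A w)
    rw [ContinuousLinearMap.comp_apply] at this
    exact (congrArg (fun z => ‖T.symmL ℝ y z‖) (hTx w)).symm.trans_le this
  have hsymm : φ.target ∩ φ.symm ⁻¹' u ∈ 𝓝 (φ x) := by
    refine inter_mem (φ.open_target.mem_nhds (φ.map_source hxφ)) ?_
    exact (φ.continuousAt_symm (φ.map_source hxφ)).preimage_mem_nhds (by rwa [φ.left_inv hxφ])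
  obtain ⟨δ, hδ, hball⟩ := Metric.mem_nhds_iff.1 hsymm
  filter_upwards [(φ.continuousAt hxφ).preimage_mem_nhds (Metric.ball_mem_nhds _ hδ),
    φ.open_source.mem_nhds hxφ] with y hy hyφ
  -- The competitor is the straight segment in the chart, which stays in a ball on which the metric
  -- is compared with the one at `x`.
  let η : ℝ → EuclideanSpace ℝ (Fin n) := fun t => φ x + t • (φ y - φ x)
  have hη : MapsTo η (Icc 0 1) (φ.target ∩ φ.symm ⁻¹' u) := by
    intro t ht
    refine hball ?_
    exact (convex_ball (φ x) δ).add_smul_sub_mem (Metric.mem_ball_self hδ) hy ht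
  have hη' : ∀ t, HasDerivAt η (φ y - φ x) t := fun t => by
    have := ((hasDerivAt_id t).smul_const (φ y - φ x)).const_add (φ x)
    rwa [one_smul] at this
  have hηs : ContMDiffOn 𝓘(ℝ, ℝ) (𝓡 n) 1 η (Icc 0 1) := by
    rw [contMDiffOn_iff_contDiffOn]
    exact ContDiff.contDiffOn (by fun_prop)
  have hφ1 : ContMDiffOn (𝓡 n) (𝓡 n) 1 φ.symm φ.target := contMDiffOn_chart_symm
  have hlen : riemannianEDist (𝓡 n) x y ≤ pathELength (𝓡 n) (φ.symm ∘ η) 0 1 := by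
    refine riemannianEDist_le_pathELength (hφ1.comp hηs fun t ht => (hη ht).1) ?_ ?_ zero_le_one
    · simp [η, φ.left_inv hxφ]
    · simp [η, φ.left_inv hyφ]
  refine hlen.trans ?_
  rw [pathELength_eq_lintegral_mfderiv_Icc]
  have hb : ∀ t ∈ Icc (0 : ℝ) 1, ‖mfderiv 𝓘(ℝ, ℝ) (𝓡 n) (φ.symm ∘ η) t 1‖ₑ ≤
      ENNReal.ofReal r * ‖A (φ y - φ x)‖ₑ := by
    intro t ht
    have h1 : mfderiv 𝓘(ℝ, ℝ) (𝓡 n) (φ.symm ∘ η) t =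
        (mfderiv (𝓡 n) (𝓡 n) φ.symm (η t)).comp (mfderiv 𝓘(ℝ, ℝ) (𝓡 n) η t) := by
      apply mfderiv_comp
      · exact ((hφ1 _ (hη ht).1).contMDiffAt (φ.open_target.mem_nhds (hη ht).1)).mdifferentiableAt
          one_ne_zero
      · exact (hη' t).differentiableAt.mdifferentiableAt
    have h2 : mfderiv 𝓘(ℝ, ℝ) (𝓡 n) η t 1 = φ y - φ x := by
      rw [mfderiv_eq_fderiv]
      exact (hη' t).hasFDerivAt.fderiv ▸ one_smul ℝ (φ y - φ x)
    have h3 : mfderiv 𝓘(ℝ, ℝ) (𝓡 n) (φ.symm ∘ η) t 1 =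
        mfderiv (𝓡 n) (𝓡 n) φ.symm (η t) (φ y - φ x) := by
      rw [← h2]
      exact congr($h1 1)
    rw [h3, ← ofReal_norm, ← ofReal_norm, ← ENNReal.ofReal_mul hr0]
    refine ENNReal.ofReal_le_ofReal ?_
    rw [← symmL_apply_eq_mfderiv_chartAt_symm (hη ht).1]
    exact (hη ht).2.2 (φ y - φ x)
  refine (setLIntegral_mono' measurableSet_Icc hb).trans ?_
  simp

end Distance

/-! ### From bounds for the distances to bounds for the derivative. -/

section Bilipschitz

variable {n : ℕ}
  {M : Type*} [TopologicalSpace M] [ChartedSpace (EuclideanSpace ℝ (Fin n)) M]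
  {N : Type*} [TopologicalSpace N] [ChartedSpace (EuclideanSpace ℝ (Fin n)) N]

theorem regularSpace_of_chartedSpace (M : Type*) [TopologicalSpace M] [T2Space M]
    [ChartedSpace (EuclideanSpace ℝ (Fin n)) M] : RegularSpace M := by
  have := ChartedSpace.locallyCompactSpace (EuclideanSpace ℝ (Fin n)) M
  infer_instance

variable [IsManifold (𝓡 n) ∞ M] [IsManifold (𝓡 n) ∞ N]
  [RiemannianBundle (fun y : N => TangentSpace (𝓡 n) y)]

/-- The derivative of a map read along a line in a chart. -/
theorem hasDerivAt_symmL_chartAt_comp {f : M → N} {x : M} (hf : MDifferentiableAt (𝓡 n) (𝓡 n) f x)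
    (v : TangentSpace (𝓡 n) x) :
    HasDerivAt (fun t : ℝ =>
      (trivializationAt (EuclideanSpace ℝ (Fin n)) (TangentSpace (𝓡 n)) (f x)).symmL ℝ (f x)
        (chartAt (EuclideanSpace ℝ (Fin n)) (f x) (f ((chartAt (EuclideanSpace ℝ (Fin n)) x).symm
          (chartAt (EuclideanSpace ℝ (Fin n)) x x + t • (trivializationAt (EuclideanSpace ℝ (Fin n))
            (TangentSpace (𝓡 n)) x).continuousLinearMapAt ℝ x v)))))
      (mfderiv (𝓡 n) (𝓡 n) f x v) 0 := by
  set φ := chartAt (EuclideanSpace ℝ (Fin n)) x with hφ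
  set ψ := chartAt (EuclideanSpace ℝ (Fin n)) (f x) with hψ
  set T := trivializationAt (EuclideanSpace ℝ (Fin n)) (TangentSpace (𝓡 n)) x with hT
  set S := trivializationAt (EuclideanSpace ℝ (Fin n)) (TangentSpace (𝓡 n)) (f x) with hS
  have hxφ : x ∈ φ.source := mem_chart_source _ x
  have hxψ : f x ∈ ψ.source := mem_chart_source _ (f x)
  set w := T.continuousLinearMapAt ℝ x v with hw
  have hφ1 : MDifferentiableAt (𝓡 n) (𝓡 n) φ.symm (φ x) :=
    mdifferentiableAt_atlas_symm (chart_mem_atlas _ x) (φ.map_source hxφ)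
  have hψ1 : MDifferentiableAt (𝓡 n) (𝓡 n) ψ (f x) :=
    mdifferentiableAt_atlas (chart_mem_atlas _ (f x)) hxψ
  have hv : mfderiv (𝓡 n) (𝓡 n) φ.symm (φ x) w = v := by
    rw [← symmL_eq_mfderiv_chartAt_symm hxφ]
    exact T.symmL_continuousLinearMapAt (FiberBundle.mem_baseSet_trivializationAt' x) v
  have hG : MDifferentiableAt (𝓡 n) (𝓡 n) (ψ ∘ f) x := hψ1.comp x hf
  have hfd : HasFDerivAt ((ψ ∘ f) ∘ φ.symm) (mfderiv (𝓡 n) (𝓡 n) ((ψ ∘ f) ∘ φ.symm) (φ x)) (φ x) :=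
    (MDifferentiableAt.comp_of_eq (φ x) hG hφ1 (φ.left_inv hxφ)).hasMFDerivAt.hasFDerivAt
  have hval : mfderiv (𝓡 n) (𝓡 n) ((ψ ∘ f) ∘ φ.symm) (φ x) w =
      mfderiv (𝓡 n) (𝓡 n) ψ (f x) (mfderiv (𝓡 n) (𝓡 n) f x v) := by
    refine (mfderiv_comp_apply_of_eq (φ x) hG hφ1 (φ.left_inv hxφ) w).trans ?_
    refine (mfderiv_comp_apply x hψ1 hf _).trans ?_
    exact congrArg (fun z => mfderiv (𝓡 n) (𝓡 n) ψ (f x) (mfderiv (𝓡 n) (𝓡 n) f x z)) hv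
  have hline : HasDerivAt (fun t : ℝ => φ x + t • w) w 0 := by
    have := ((hasDerivAt_id (0 : ℝ)).smul_const w).const_add (φ x)
    rwa [one_smul] at this
  have h0 : φ x + (0 : ℝ) • w = φ x := by simp
  have h1 : HasDerivAt (((ψ ∘ f) ∘ φ.symm) ∘ fun t : ℝ => φ x + t • w)
      (mfderiv (𝓡 n) (𝓡 n) ((ψ ∘ f) ∘ φ.symm) (φ x) w) 0 :=
    HasFDerivAt.comp_hasDerivAt_of_eq (0 : ℝ) hfd hline h0.symm
  have h2 := (S.symmL ℝ (f x)).hasFDerivAt.comp_hasDerivAt (0 : ℝ) h1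
  rw [hval, ← continuousLinearMapAt_eq_mfderiv_chartAt hxψ] at h2
  have h3 := S.symmL_continuousLinearMapAt (R := ℝ)
    (FiberBundle.mem_baseSet_trivializationAt' (f x)) (mfderiv (𝓡 n) (𝓡 n) f x v)
  exact HasDerivAt.congr_deriv h2 h3

/-- The difference quotients at 0 have norm at least `c`, and this passes to the limit. It is the
lower counterpart of `HasDerivAt.le_of_lip'`. -/
theorem le_norm_of_eventually_mul_le {V : Type*} [NormedAddCommGroup V] [NormedSpace ℝ V]
    {g : ℝ → V} {g' : V} (hg : HasDerivAt g g' 0) {c : ℝ}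
    (h : ∀ᶠ t in 𝓝 (0 : ℝ), c * |t| ≤ ‖g t - g 0‖) : c ≤ ‖g'‖ := by
  have h1 := (hasDerivAt_iff_tendsto_slope_zero.1 hg).norm
  refine ge_of_tendsto h1 ?_
  filter_upwards [nhdsWithin_le_nhds h, self_mem_nhdsWithin] with t ht ht0
  rw [zero_add, norm_smul, norm_inv, Real.norm_eq_abs, ← div_eq_inv_mul,
    le_div_iff₀ (abs_pos.2 ht0)]
  exact ht

omit [IsManifold (𝓡 n) ∞ M] in
theorem tendsto_chartAt_symm_line (x : M) (w : EuclideanSpace ℝ (Fin n)) :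
    Tendsto (fun t : ℝ => (chartAt (EuclideanSpace ℝ (Fin n)) x).symm
      (chartAt (EuclideanSpace ℝ (Fin n)) x x + t • w)) (𝓝 0) (𝓝 x) := by
  set φ := chartAt (EuclideanSpace ℝ (Fin n)) x
  have hxφ : x ∈ φ.source := mem_chart_source _ x
  have h1 : Tendsto (fun t : ℝ => φ x + t • w) (𝓝 0) (𝓝 (φ x)) :=
    Continuous.tendsto' (by fun_prop) _ _ (by simp)
  have h2 := φ.continuousAt_symm (φ.map_source hxφ)
  rw [ContinuousAt, φ.left_inv hxφ] at h2
  exact h2.comp h1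

theorem eventually_symmL_chartAt_line (x : M) (v : TangentSpace (𝓡 n) x) :
    ∀ᶠ t : ℝ in 𝓝 0,
      (trivializationAt (EuclideanSpace ℝ (Fin n)) (TangentSpace (𝓡 n)) x).symmL ℝ x
        (chartAt (EuclideanSpace ℝ (Fin n)) x ((chartAt (EuclideanSpace ℝ (Fin n)) x).symm
          (chartAt (EuclideanSpace ℝ (Fin n)) x x + t • (trivializationAt (EuclideanSpace ℝ (Fin n))
            (TangentSpace (𝓡 n)) x).continuousLinearMapAt ℝ x v)) -
          chartAt (EuclideanSpace ℝ (Fin n)) x x) = t • v := by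
  set T := trivializationAt (EuclideanSpace ℝ (Fin n)) (TangentSpace (𝓡 n)) x
  set φ := chartAt (EuclideanSpace ℝ (Fin n)) x
  set w := T.continuousLinearMapAt ℝ x v
  have hxφ : x ∈ φ.source := mem_chart_source _ x
  have h1 : Tendsto (fun t : ℝ => φ x + t • w) (𝓝 0) (𝓝 (φ x)) :=
    Continuous.tendsto' (by fun_prop) _ _ (by simp)
  filter_upwards [h1 (φ.open_target.mem_nhds (φ.map_source hxφ))] with t ht
  rw [φ.right_inv ht, add_sub_cancel_left, map_smul]
  exact congrArg (t • ·)
    (T.symmL_continuousLinearMapAt (FiberBundle.mem_baseSet_trivializationAt' x) v)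

/-- Let `r` tend to 1. One factor `r` is lost in comparing distance and norm in the source, the
other in the target. -/
theorem le_of_forall_one_lt_le_sq_mul {a b : ℝ} (h : ∀ r : ℝ, 1 < r → a ≤ r * (r * b)) :
    a ≤ b := by
  have h1 : Tendsto (fun r : ℝ => r * (r * b)) (𝓝[>] 1) (𝓝 b) :=
    (Continuous.tendsto' (by fun_prop) _ _ (by simp)).mono_left nhdsWithin_le_nhds
  exact ge_of_tendsto h1 (eventually_mem_nhdsWithin.mono fun r hr => h r hr)

variable [RiemannianBundle (fun x : M => TangentSpace (𝓡 n) x)]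
  [IsContMDiffRiemannianBundle (𝓡 n) ∞ (EuclideanSpace ℝ (Fin n))
      (fun x : M => TangentSpace (𝓡 n) x)]
  [IsContMDiffRiemannianBundle (𝓡 n) ∞ (EuclideanSpace ℝ (Fin n))
      (fun y : N => TangentSpace (𝓡 n) y)]

/-- The derivative of a map between Riemannian manifolds is controlled by its Lipschitz constant for
the Riemannian distances. -/
theorem norm_mfderiv_le_of_riemannianEDist_le [T2Space N] {f : M → N} {x : M}
    (hf : MDifferentiableAt (𝓡 n) (𝓡 n) f x) {L : ℝ} (hL : 0 ≤ L)
    (h : ∀ y, riemannianEDist (𝓡 n) (f x) (f y) ≤ ENNReal.ofReal L * riemannianEDist (𝓡 n) x y)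
    (v : TangentSpace (𝓡 n) x) : ‖mfderiv (𝓡 n) (𝓡 n) f x v‖ ≤ L * ‖v‖ := by
  have := regularSpace_of_chartedSpace (n := n) N
  refine le_of_forall_one_lt_le_sq_mul fun r hr => ?_
  have hr0 : 0 ≤ r := zero_le_one.trans hr.le
  set w := (trivializationAt (EuclideanSpace ℝ (Fin n)) (TangentSpace (𝓡 n)) x).continuousLinearMapAt
    ℝ x v with hw
  have hγ := tendsto_chartAt_symm_line x w
  have hd := hasDerivAt_symmL_chartAt_comp hf v
  rw [← hw] at hd
  refine HasDerivAt.le_of_lip' hd (by positivity) ?_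
  filter_upwards [hγ (eventually_riemannianEDist_le_enorm_chartAt_sub (n := n) x hr),
    (hf.continuousAt.tendsto.comp hγ) (eventually_enorm_chartAt_sub_le (n := n) (f x) hr),
    eventually_symmL_chartAt_line x v] with t h1 h2 h3
  rw [mem_preimage, mem_ofPred_eq, h3] at h1
  rw [zero_smul, add_zero, (chartAt (EuclideanSpace ℝ (Fin n)) x).left_inv (mem_chart_source _ x),
    ← map_sub, sub_zero]
  -- The chain is: norm at `f x`, distance in `N`, distance in `M`, norm at `x`; the first and last
  -- comparison cost a factor `r` each.
  have h4 := h2.trans (mul_le_mul_right ((h _).trans (mul_le_mul_right h1 _)) _)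
  rw [← ofReal_norm, ← ofReal_norm, ← ENNReal.ofReal_mul hr0, ← ENNReal.ofReal_mul hL,
    ← ENNReal.ofReal_mul hr0, ENNReal.ofReal_le_ofReal_iff (by positivity), norm_smul] at h4
  exact h4.trans (le_of_eq (by ring))

/-- The derivative of a map between Riemannian manifolds is bounded from below if the map expands
the Riemannian distances. -/
theorem le_norm_mfderiv_of_le_riemannianEDist [T2Space M] {f : M → N} {x : M}
    (hf : MDifferentiableAt (𝓡 n) (𝓡 n) f x) {L : ℝ} (hL : 0 ≤ L)
    (h : ∀ y, ENNReal.ofReal L * riemannianEDist (𝓡 n) x y ≤ riemannianEDist (𝓡 n) (f x) (f y))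
    (v : TangentSpace (𝓡 n) x) : L * ‖v‖ ≤ ‖mfderiv (𝓡 n) (𝓡 n) f x v‖ := by
  have := regularSpace_of_chartedSpace (n := n) M
  refine le_of_forall_one_lt_le_sq_mul fun r hr => ?_
  have hr0 : 0 < r := zero_lt_one.trans hr
  set w := (trivializationAt (EuclideanSpace ℝ (Fin n)) (TangentSpace (𝓡 n)) x).continuousLinearMapAt
    ℝ x v with hw
  have hγ := tendsto_chartAt_symm_line x w
  have hd := hasDerivAt_symmL_chartAt_comp hf v
  rw [← hw] at hd
  rw [← mul_assoc, ← inv_mul_le_iff₀ (by positivity)]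
  refine le_norm_of_eventually_mul_le hd ?_
  filter_upwards [hγ (eventually_enorm_chartAt_sub_le (n := n) x hr),
    (hf.continuousAt.tendsto.comp hγ)
      (eventually_riemannianEDist_le_enorm_chartAt_sub (n := n) (f x) hr),
    eventually_symmL_chartAt_line x v] with t h1 h2 h3
  rw [mem_preimage, mem_ofPred_eq, h3] at h1
  rw [zero_smul, add_zero, (chartAt (EuclideanSpace ℝ (Fin n)) x).left_inv (mem_chart_source _ x),
    ← map_sub]
  have h4 := (mul_le_mul_right h1 (ENNReal.ofReal L)).trans
    ((mul_left_comm _ _ _).trans_le (mul_le_mul_right ((h _).trans h2) _))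
  rw [← ofReal_norm, ← ofReal_norm, ← ENNReal.ofReal_mul hr0.le, ← ENNReal.ofReal_mul hL,
    ← ENNReal.ofReal_mul hr0.le, ENNReal.ofReal_le_ofReal_iff (by positivity), norm_smul] at h4
  rw [mul_assoc, inv_mul_le_iff₀ (by positivity), mul_assoc r r]
  exact (le_of_eq (by rw [Real.norm_eq_abs]; ring)).trans h4

/-- Injectivity holds because points at Riemannian distance zero coincide: small distance balls lie
inside any given neighbourhood. The derivative bounds are the first-order form of the two distance
inequalities. -/
theorem IsBilipschitz.isInfinitesimallyBilipschitz [T2Space M] [T2Space N] {f : M → N}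
    (hf : ContMDiff (𝓡 n) (𝓡 n) ∞ f) {L : ℝ} (hL : 0 < L) (h : IsBilipschitz n L f) :
    IsInfinitesimallyBilipschitz n L f := by
  have := regularSpace_of_chartedSpace (n := n) M
  have := isContinuousRiemannianBundle_tangent (n := n) (M := M)
  refine ⟨fun x y hxy => ?_, fun x v => ⟨?_, ?_⟩⟩
  · have h1 := (h x y).1
    rw [hxy, riemannianEDist_self, nonpos_iff_eq_zero, mul_eq_zero] at h1
    have h2 : riemannianEDist (𝓡 n) x y = 0 :=
      h1.resolve_left (by simpa using hL)
    by_contra hne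
    obtain ⟨c, hc, hcs⟩ := setOfPred_riemannianEDist_lt_subset_nhds' (𝓡 n)
      (isOpen_compl_singleton.mem_nhds (show x ∈ ({y} : Set M)ᶜ from hne))
    exact hcs (show riemannianEDist (𝓡 n) x y < c from h2 ▸ hc) rfl
  · exact le_norm_mfderiv_of_le_riemannianEDist (hf.mdifferentiableAt (by simp)) (by positivity)
      (fun y => (h x y).1) v
  · exact norm_mfderiv_le_of_riemannianEDist_le (hf.mdifferentiableAt (by simp)) hL.le
      (fun y => (h x y).2) v

end Bilipschitz

/-! ### Partial diffeomorphisms and charts -/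

section PartialDiffeo

variable {n : ℕ}
  {M : Type*} [TopologicalSpace M] [ChartedSpace (EuclideanSpace ℝ (Fin n)) M]
  {N : Type*} [TopologicalSpace N] [ChartedSpace (EuclideanSpace ℝ (Fin n)) N]
  {P : Type*} [TopologicalSpace P] [ChartedSpace (EuclideanSpace ℝ (Fin n)) P]

variable (n) in
/-- An open partial homeomorphism that is smooth together with its inverse. -/
def IsPartialDiffeo (F : OpenPartialHomeomorph M N) : Prop :=
  ContMDiffOn (𝓡 n) (𝓡 n) ∞ F F.source ∧ ContMDiffOn (𝓡 n) (𝓡 n) ∞ F.symm F.target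

theorem IsPartialDiffeo.symm {F : OpenPartialHomeomorph M N} (hF : IsPartialDiffeo n F) :
    IsPartialDiffeo n F.symm := ⟨hF.2, by simpa using hF.1⟩

theorem IsPartialDiffeo.trans {F : OpenPartialHomeomorph M N} (hF : IsPartialDiffeo n F)
    {G : OpenPartialHomeomorph N P} (hG : IsPartialDiffeo n G) : IsPartialDiffeo n (F ≫ₕ G) := by
  constructor
  · rw [OpenPartialHomeomorph.trans_source]
    exact hG.1.comp (hF.1.mono inter_subset_left) fun x hx => hx.2
  · rw [OpenPartialHomeomorph.trans_target]
    exact hF.2.comp (hG.2.mono inter_subset_left) fun x hx => hx.2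

theorem IsPartialDiffeo.mdifferentiableAt {F : OpenPartialHomeomorph M N}
    (hF : IsPartialDiffeo n F) {x : M} (hx : x ∈ F.source) :
    MDifferentiableAt (𝓡 n) (𝓡 n) F x :=
  ((hF.1 x hx).contMDiffAt (F.open_source.mem_nhds hx)).mdifferentiableAt (by simp)

theorem IsPartialDiffeo.mdifferentiable {F : OpenPartialHomeomorph M N}
    (hF : IsPartialDiffeo n F) : F.MDifferentiable (𝓡 n) (𝓡 n) :=
  ⟨fun _ hx => (hF.mdifferentiableAt hx).mdifferentiableWithinAt,
    fun _ hx => (hF.symm.mdifferentiableAt hx).mdifferentiableWithinAt⟩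

theorem isPartialDiffeo_of_mem_maximalAtlas [IsManifold (𝓡 n) ∞ M]
    {φ : OpenPartialHomeomorph M (EuclideanSpace ℝ (Fin n))}
    (hφ : φ ∈ IsManifold.maximalAtlas (𝓡 n) ∞ M) : IsPartialDiffeo n φ :=
  (IsManifold.mem_maximalAtlas_iff_contMDiffOn φ).1 hφ

theorem IsPartialDiffeo.mem_maximalAtlas [IsManifold (𝓡 n) ∞ M]
    {φ : OpenPartialHomeomorph M (EuclideanSpace ℝ (Fin n))}
    (hφ : IsPartialDiffeo n φ) : φ ∈ IsManifold.maximalAtlas (𝓡 n) ∞ M :=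
  (IsManifold.mem_maximalAtlas_iff_contMDiffOn φ).2 hφ

/-- A chart of `M` transported to `N` by a partial diffeomorphism. -/
theorem IsPartialDiffeo.symm_trans_mem_maximalAtlas [IsManifold (𝓡 n) ∞ M] [IsManifold (𝓡 n) ∞ N]
    {F : OpenPartialHomeomorph M N} (hF : IsPartialDiffeo n F)
    {φ : OpenPartialHomeomorph M (EuclideanSpace ℝ (Fin n))}
    (hφ : φ ∈ IsManifold.maximalAtlas (𝓡 n) ∞ M) :
    F.symm ≫ₕ φ ∈ IsManifold.maximalAtlas (𝓡 n) ∞ N :=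
  (hF.symm.trans (isPartialDiffeo_of_mem_maximalAtlas hφ)).mem_maximalAtlas

/-! ### Local inversion and open embeddings. -/

section InverseFunction

variable [IsManifold (𝓡 n) ∞ M] [IsManifold (𝓡 n) ∞ N]

/-- The coordinate expression of a smooth map with injective derivative is smooth and has an
invertible derivative. -/
theorem exists_hasFDerivAt_equiv {f : M → N} (hf : ContMDiff (𝓡 n) (𝓡 n) ∞ f) {x : M}
    (hinj : Function.Injective (mfderiv (𝓡 n) (𝓡 n) f x)) :
    ContDiffAt ℝ ∞ ((chartAt (EuclideanSpace ℝ (Fin n)) (f x) ∘ f) ∘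
        (chartAt (EuclideanSpace ℝ (Fin n)) x).symm) (chartAt (EuclideanSpace ℝ (Fin n)) x x) ∧
      ∃ A : EuclideanSpace ℝ (Fin n) ≃L[ℝ] EuclideanSpace ℝ (Fin n),
      HasFDerivAt ((chartAt (EuclideanSpace ℝ (Fin n)) (f x) ∘ f) ∘
        (chartAt (EuclideanSpace ℝ (Fin n)) x).symm)
        (A : EuclideanSpace ℝ (Fin n) →L[ℝ] EuclideanSpace ℝ (Fin n))
        (chartAt (EuclideanSpace ℝ (Fin n)) x x) := by
  set φ := chartAt (EuclideanSpace ℝ (Fin n)) x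
  set ψ := chartAt (EuclideanSpace ℝ (Fin n)) (f x)
  have hxφ : x ∈ φ.source := mem_chart_source _ x
  have hxψ : f x ∈ ψ.source := mem_chart_source _ (f x)
  have hφ : IsPartialDiffeo n φ :=
    isPartialDiffeo_of_mem_maximalAtlas (IsManifold.chart_mem_maximalAtlas x)
  have hψ : IsPartialDiffeo n ψ :=
    isPartialDiffeo_of_mem_maximalAtlas (IsManifold.chart_mem_maximalAtlas (f x))
  have hs : ContMDiffAt (𝓡 n) (𝓡 n) ∞ ((ψ ∘ f) ∘ φ.symm) (φ x) := by
    refine ContMDiffAt.comp_of_eq (y := x) ?_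
      ((hφ.2 _ (φ.map_source hxφ)).contMDiffAt (φ.open_target.mem_nhds (φ.map_source hxφ)))
      (φ.left_inv hxφ)
    exact ((hψ.1 _ hxψ).contMDiffAt (ψ.open_source.mem_nhds hxψ)).comp x (hf x)
  refine ⟨contMDiffAt_iff_contDiffAt.1 hs, ?_⟩
  have hfx := hf.mdifferentiableAt (x := x) (by simp)
  have hψx := hψ.mdifferentiableAt hxψ
  have hφx := hφ.symm.mdifferentiableAt (φ.map_source hxφ)
  let B : EuclideanSpace ℝ (Fin n) →L[ℝ] EuclideanSpace ℝ (Fin n) :=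
    mfderiv (𝓡 n) (𝓡 n) ((ψ ∘ f) ∘ φ.symm) (φ x)
  have hB : HasFDerivAt ((ψ ∘ f) ∘ φ.symm) B (φ x) :=
    (hs.mdifferentiableAt (by simp)).hasMFDerivAt.hasFDerivAt
  have hBinj : Function.Injective B := by
    have h1 : ∀ w, B w = mfderiv (𝓡 n) (𝓡 n) ψ (f x) (mfderiv (𝓡 n) (𝓡 n) f x
        (mfderiv (𝓡 n) (𝓡 n) φ.symm (φ x) w)) := by
      intro w
      refine (mfderiv_comp_apply_of_eq (φ x) (hψx.comp x hfx) hφx (φ.left_inv hxφ) w).trans ?_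
      exact mfderiv_comp_apply x hψx hfx _
    intro w w' hw
    rw [h1, h1] at hw
    exact hφ.mdifferentiable.symm.mfderiv_injective (φ.map_source hxφ)
      (hinj (hψ.mdifferentiable.mfderiv_injective hxψ hw))
  let A := (LinearEquiv.ofInjectiveEndo (B : EuclideanSpace ℝ (Fin n) →ₗ[ℝ] _)
    hBinj).toContinuousLinearEquiv
  refine ⟨A, ?_⟩
  have hA : (A : EuclideanSpace ℝ (Fin n) →L[ℝ] EuclideanSpace ℝ (Fin n)) = B := by
    ext w
    rfl
  rwa [hA]

/-- By the inverse function theorem the coordinate expression maps neighbourhoods of a point onto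
neighbourhoods of its image; composing with the charts carries this back to the manifolds. -/
theorem isOpenMap_of_injective_mfderiv {f : M → N} (hf : ContMDiff (𝓡 n) (𝓡 n) ∞ f)
    (hinj : ∀ x, Function.Injective (mfderiv (𝓡 n) (𝓡 n) f x)) : IsOpenMap f := by
  refine isOpenMap_iff_nhds_le.2 fun x => ?_
  obtain ⟨hs, A, hA⟩ := exists_hasFDerivAt_equiv hf (hinj x)
  set φ := chartAt (EuclideanSpace ℝ (Fin n)) x
  set ψ := chartAt (EuclideanSpace ℝ (Fin n)) (f x)
  have hxφ : x ∈ φ.source := mem_chart_source _ x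
  have hxψ : f x ∈ ψ.source := mem_chart_source _ (f x)
  have h1 : map ((ψ ∘ f) ∘ φ.symm) (𝓝 (φ x)) = 𝓝 (ψ (f x)) := by
    have := (hs.hasStrictFDerivAt' hA (by simp)).map_nhds_eq_of_equiv
    simpa [φ.left_inv hxφ] using this
  rw [← Filter.map_map, φ.symm_map_nhds_eq hxφ, ← Filter.map_map] at h1
  have h2 : map ψ.symm (map ψ (map f (𝓝 x))) = map f (𝓝 x) := by
    rw [Filter.map_map]
    refine (Filter.map_congr ?_).trans Filter.map_id
    have : Tendsto f (𝓝 x) (𝓝 (f x)) := hf.continuous.continuousAt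
    exact this (ψ.eventually_left_inverse hxψ)
  rw [← h2, h1, ψ.symm_map_nhds_eq hxψ]

/-- A smooth injective map between manifolds of the same dimension with injective derivatives is a
diffeomorphism onto an open subset. -/
theorem exists_isPartialDiffeo [Nonempty M] {f : M → N} (hf : ContMDiff (𝓡 n) (𝓡 n) ∞ f)
    (hfi : Function.Injective f)
    (hinj : ∀ x, Function.Injective (mfderiv (𝓡 n) (𝓡 n) f x)) :
    ∃ F : OpenPartialHomeomorph M N, F.source = univ ∧ ⇑F = f ∧ IsPartialDiffeo n F := by
  have hemb : Topology.IsOpenEmbedding f :=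
    .of_continuous_injective_isOpenMap hf.continuous hfi (isOpenMap_of_injective_mfderiv hf hinj)
  let F := hemb.toOpenPartialHomeomorph f
  have hFs : F.source = univ := rfl
  have hFf : ⇑F = f := rfl
  refine ⟨F, hFs, hFf, hf.contMDiffOn, fun y hy => ?_⟩
  obtain ⟨x, rfl⟩ : ∃ x, f x = y := ⟨F.symm y, F.right_inv hy⟩
  have hFx : F.symm (f x) = x := F.left_inv (hFs ▸ mem_univ x)
  obtain ⟨hs, A, hA⟩ := exists_hasFDerivAt_equiv hf (hinj x)
  set φ := chartAt (EuclideanSpace ℝ (Fin n)) x with hφ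
  set ψ := chartAt (EuclideanSpace ℝ (Fin n)) (f x) with hψ
  have hxφ : x ∈ φ.source := mem_chart_source _ x
  have hxψ : f x ∈ ψ.source := mem_chart_source _ (f x)
  -- `e` is `F` in coordinates. It is already a homeomorphism with smooth forward map and invertible
  -- derivative, so its given inverse is smooth.
  let e := φ.symm ≫ₕ (F ≫ₕ ψ)
  have hmem : φ x ∈ e.source := by
    simp [e, hFs, φ.map_source hxφ, φ.left_inv hxφ, hFf, hxψ]
  have hval : e (φ x) = ψ (f x) := by simp [e, hFf, φ.left_inv hxφ]
  have hsymm : e.symm (ψ (f x)) = φ x := by rw [← hval, e.left_inv hmem]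
  have h1 : ContDiffAt ℝ ∞ e.symm (ψ (f x)) := by
    refine e.contDiffAt_symm (hval ▸ e.map_source hmem) (f₀' := A) ?_ ?_
    · rw [hsymm]; exact hA
    · rw [hsymm]; exact hs
  refine ContMDiffAt.contMDiffWithinAt ?_
  rw [contMDiffAt_iff_of_mem_maximalAtlas (IsManifold.chart_mem_maximalAtlas (f x))
    (IsManifold.chart_mem_maximalAtlas x) hxψ (by rwa [hFx])]
  refine ⟨F.continuousAt_symm hy, ?_⟩
  have h2 : ContDiffAt ℝ ∞ (φ ∘ F.symm ∘ ψ.symm) (ψ (f x)) := h1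
  simpa using h2.contDiffWithinAt

end InverseFunction

end PartialDiffeo

/-! ### Pull-back of forms and the exterior derivative -/

section Pullback

variable {n : ℕ}
  {M : Type*} [TopologicalSpace M] [ChartedSpace (EuclideanSpace ℝ (Fin n)) M]
  {N : Type*} [TopologicalSpace N] [ChartedSpace (EuclideanSpace ℝ (Fin n)) N]
  {P : Type*} [TopologicalSpace P] [ChartedSpace (EuclideanSpace ℝ (Fin n)) P] {k : ℕ}

theorem pullback_apply_apply (f : M → N) (α : DiffForm n N k) (x : M)
    (v : Fin k → TangentSpace (𝓡 n) x) :
    pullback f α x v = α (f x) (fun i => mfderiv (𝓡 n) (𝓡 n) f x (v i)) := rfl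

theorem inChart_eq_pullback (φ : OpenPartialHomeomorph M (EuclideanSpace ℝ (Fin n)))
    (α : DiffForm n M k) : inChart φ α = pullback φ.symm α := rfl

/-- The two values involve fibres over `f x` and `g x`. All tangent spaces are by definition the
model space, and viewing `α` as a function with values in a fixed space allows the base point to be
rewritten. -/
theorem pullback_congr_of_eventuallyEq {f g : M → N} {x : M} (h : f =ᶠ[𝓝 x] g)
    (α : DiffForm n N k) : pullback f α x = pullback g α x := by
  let β : N → (EuclideanSpace ℝ (Fin n)) [⋀^Fin k]→L[ℝ] ℝ := α
  let A : EuclideanSpace ℝ (Fin n) →L[ℝ] EuclideanSpace ℝ (Fin n) := mfderiv (𝓡 n) (𝓡 n) f x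
  let B : EuclideanSpace ℝ (Fin n) →L[ℝ] EuclideanSpace ℝ (Fin n) := mfderiv (𝓡 n) (𝓡 n) g x
  have hAB : A = B := h.mfderiv_eq
  change (β (f x)).compContinuousLinearMap A = (β (g x)).compContinuousLinearMap B
  rw [hAB, h.eq_of_nhds]

theorem pullback_comp {f : M → N} {g : P → M} {x : P} (hf : MDifferentiableAt (𝓡 n) (𝓡 n) f (g x))
    (hg : MDifferentiableAt (𝓡 n) (𝓡 n) g x) (α : DiffForm n N k) :
    pullback (f ∘ g) α x = pullback g (pullback f α) x := by
  ext v
  rw [pullback_apply_apply, pullback_apply_apply, pullback_apply_apply]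
  simp only [mfderiv_comp_apply x hf hg]
  rfl

theorem pullback_congr_form {f : M → N} {x : M} {α β : DiffForm n N k} (h : α (f x) = β (f x)) :
    pullback f α x = pullback f β x := by
  rw [pullback, pullback, h]

theorem pullback_smul (f : M → N) (c : N → ℝ) (α : DiffForm n N k) (x : M) :
    pullback f (fun y => c y • α y) x = c (f x) • pullback f α x := rfl

/-- The coordinate expression of `F^* α` in a chart `φ` is that of `α` in the transported chart. -/
theorem inChart_symm_trans {F : OpenPartialHomeomorph M N} (hF : IsPartialDiffeo n F)
    {φ : OpenPartialHomeomorph M (EuclideanSpace ℝ (Fin n))} (hφ : IsPartialDiffeo n φ)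
    (α : DiffForm n N k) {z : EuclideanSpace ℝ (Fin n)} (hz : z ∈ (F.symm ≫ₕ φ).target) :
    inChart (F.symm ≫ₕ φ) α z = inChart φ (pullback F α) z := by
  rw [OpenPartialHomeomorph.trans_target] at hz
  exact pullback_comp (f := F) (g := φ.symm) (hF.mdifferentiableAt hz.2)
    (hφ.symm.mdifferentiableAt hz.1) α

theorem coordVector_symm_trans {F : OpenPartialHomeomorph M N} (hF : IsPartialDiffeo n F)
    {φ : OpenPartialHomeomorph M (EuclideanSpace ℝ (Fin n))} (hφ : IsPartialDiffeo n φ)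
    {z : EuclideanSpace ℝ (Fin n)} (hz : z ∈ (F.symm ≫ₕ φ).target) (i : Fin n) :
    coordVector (F.symm ≫ₕ φ) z i =
      mfderiv (𝓡 n) (𝓡 n) F (φ.symm z) (coordVector φ z i) := by
  rw [OpenPartialHomeomorph.trans_target] at hz
  exact mfderiv_comp_apply z (hF.mdifferentiableAt hz.2) (hφ.symm.mdifferentiableAt hz.1) _

/-- The exterior derivative of the coordinate expression of a form, as a form on `ℝⁿ`. -/
def chartExtDeriv (φ : OpenPartialHomeomorph M (EuclideanSpace ℝ (Fin n))) (η : DiffForm n M k) :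
    DiffForm n (EuclideanSpace ℝ (Fin n)) (k + 1) :=
  extDeriv (inChart φ η)

/-! ### Forms and their exterior derivatives under a change of charts. -/

section Transition

variable {φ ψ : OpenPartialHomeomorph M (EuclideanSpace ℝ (Fin n))}

theorem IsPartialDiffeo.contDiffAt_transition (hφ : IsPartialDiffeo n φ) (hψ : IsPartialDiffeo n ψ)
    {z : EuclideanSpace ℝ (Fin n)} (hz : z ∈ (φ.symm ≫ₕ ψ).source) :
    ContDiffAt ℝ ∞ (ψ ∘ φ.symm) z :=
  contMDiffAt_iff_contDiffAt.1
    (((hφ.symm.trans hψ).1 z hz).contMDiffAt ((φ.symm ≫ₕ ψ).open_source.mem_nhds hz))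

omit [ChartedSpace (EuclideanSpace ℝ (Fin n)) M] in
theorem eventuallyEq_symm_comp_transition {z : EuclideanSpace ℝ (Fin n)}
    (hz : z ∈ (φ.symm ≫ₕ ψ).source) : φ.symm =ᶠ[𝓝 z] ψ.symm ∘ (ψ ∘ φ.symm) := by
  filter_upwards [(φ.symm ≫ₕ ψ).open_source.mem_nhds hz] with z' hz'
  rw [OpenPartialHomeomorph.trans_source] at hz'
  exact (ψ.left_inv hz'.2).symm

theorem inChart_transition (hφ : IsPartialDiffeo n φ) (hψ : IsPartialDiffeo n ψ)
    (α : DiffForm n M k) {z : EuclideanSpace ℝ (Fin n)} (hz : z ∈ (φ.symm ≫ₕ ψ).source) :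
    inChart φ α z = (inChart ψ α (ψ (φ.symm z))).compContinuousLinearMap
      (fderiv ℝ (ψ ∘ φ.symm) z) := by
  have hz' := hz
  rw [OpenPartialHomeomorph.trans_source] at hz'
  rw [inChart_eq_pullback, pullback_congr_of_eventuallyEq (eventuallyEq_symm_comp_transition hz),
    pullback_comp (hψ.symm.mdifferentiableAt (ψ.map_source hz'.2))
      (f := ψ.symm) (g := ψ ∘ φ.symm) ((hφ.symm.trans hψ).mdifferentiableAt hz),
    ← mfderiv_eq_fderiv]
  rfl

/-- Near `z` one coordinate expression is the pull-back of the other by the transition map, so this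
is the naturality of `d` on `ℝⁿ`. -/
theorem extDeriv_inChart_transition (hφ : IsPartialDiffeo n φ) (hψ : IsPartialDiffeo n ψ)
    (α : DiffForm n M k) {z : EuclideanSpace ℝ (Fin n)} (hz : z ∈ (φ.symm ≫ₕ ψ).source)
    (hd : DifferentiableAt ℝ (inChart ψ α) (ψ (φ.symm z))) :
    extDeriv (inChart φ α) z = (extDeriv (inChart ψ α) (ψ (φ.symm z))).compContinuousLinearMap
      (fderiv ℝ (ψ ∘ φ.symm) z) := by
  have h : inChart φ α =ᶠ[𝓝 z] fun z' => (inChart ψ α ((ψ ∘ φ.symm) z')).compContinuousLinearMap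
      (fderiv ℝ (ψ ∘ φ.symm) z') := by
    filter_upwards [(φ.symm ≫ₕ ψ).open_source.mem_nhds hz] with z' hz'
    exact inChart_transition hφ hψ α hz'
  rw [h.extDeriv_eq]
  exact extDeriv_pullback hd (hφ.contDiffAt_transition hψ hz)
    (by
      rw [minSmoothness_of_isRCLikeNormedField]
      exact ENat.LEInfty.out)

variable [IsManifold (𝓡 n) ∞ M]

/-- The exterior derivative does not depend on the chart in which it is computed. -/
theorem extDerivForm_eq_pullback (hφ : IsPartialDiffeo n φ) {η : DiffForm n M k} {x : M}
    (hx : x ∈ φ.source) (hd : DifferentiableAt ℝ (inChart φ η) (φ x)) :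
    extDerivForm η x = pullback φ (chartExtDeriv φ η) x := by
  set c := chartAt (EuclideanSpace ℝ (Fin n)) x with hc
  have hxc : x ∈ c.source := mem_chart_source _ x
  have hcd : IsPartialDiffeo n c :=
    isPartialDiffeo_of_mem_maximalAtlas (IsManifold.chart_mem_maximalAtlas x)
  have hz : c x ∈ (c.symm ≫ₕ φ).source := by
    simp [c.map_source hxc, c.left_inv hxc, hx]
  have h1 := extDeriv_inChart_transition hcd hφ η hz (by rwa [c.left_inv hxc])
  have h2 : extDerivForm η x = pullback c (pullback (φ ∘ c.symm)
      (chartExtDeriv φ η)) x := by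
    rw [extDerivForm, ← hc, h1, ← mfderiv_eq_fderiv]
    rfl
  refine h2.trans ((pullback_comp (f := φ ∘ c.symm) (g := c)
    ((hcd.symm.trans hφ).mdifferentiableAt hz) (hcd.mdifferentiableAt hxc) _).symm.trans ?_)
  refine pullback_congr_of_eventuallyEq ?_ _
  filter_upwards [c.open_source.mem_nhds hxc] with y hy
  simp [c.left_inv hy]

theorem IsSmoothForm.differentiableAt {η : DiffForm n M k} (hη : IsSmoothForm η)
    (hφ : IsPartialDiffeo n φ) {z : EuclideanSpace ℝ (Fin n)} (hz : z ∈ φ.target) :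
    DifferentiableAt ℝ (inChart φ η) z :=
  (((hη φ hφ.mem_maximalAtlas) z hz).contDiffAt (φ.open_target.mem_nhds hz)).differentiableAt
    (by simp)

end Transition

theorem inChart_eventuallyEq {φ : OpenPartialHomeomorph M (EuclideanSpace ℝ (Fin n))}
    {η η' : DiffForm n M k} {z : EuclideanSpace ℝ (Fin n)} (hz : z ∈ φ.target)
    (h : ∀ᶠ y in 𝓝 (φ.symm z), η y = η' y) : inChart φ η =ᶠ[𝓝 z] inChart φ η' := by
  filter_upwards [(φ.continuousAt_symm hz).eventually h] with z' hz'
  exact pullback_congr_form hz'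

theorem extDerivForm_congr {η η' : DiffForm n M k} {x : M} (h : ∀ᶠ y in 𝓝 x, η y = η' y) :
    extDerivForm η x = extDerivForm η' x := by
  have hx := mem_chart_source (EuclideanSpace ℝ (Fin n)) x
  rw [extDerivForm, extDerivForm, (inChart_eventuallyEq (OpenPartialHomeomorph.map_source _ hx)
    (by rwa [OpenPartialHomeomorph.left_inv _ hx])).extDeriv_eq]

theorem extDerivForm_const_smul (c : ℝ) (η : DiffForm n M k) (x : M) :
    extDerivForm (fun y => c • η y) x = c • extDerivForm η x := by
  have h : inChart (chartAt (EuclideanSpace ℝ (Fin n)) x) (fun y => c • η y) =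
      c • inChart (chartAt (EuclideanSpace ℝ (Fin n)) x) η := rfl
  rw [extDerivForm, h, extDeriv_smul]
  rfl

theorem extDerivForm_zero (x : M) : extDerivForm (fun _ => 0 : DiffForm n M k) x = 0 := by
  simpa using extDerivForm_const_smul 0 (fun _ => 0 : DiffForm n M k) x

/-- The exterior derivative commutes with the pull-back by a partial diffeomorphism. -/
theorem extDerivForm_pullback [IsManifold (𝓡 n) ∞ M] [IsManifold (𝓡 n) ∞ N]
    {F : OpenPartialHomeomorph M N} (hF : IsPartialDiffeo n F) {β : DiffForm n N k}
    (hβ : IsSmoothForm β) {x : M} (hx : x ∈ F.source) :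
    extDerivForm (pullback F β) x = pullback F (extDerivForm β) x := by
  set φ := chartAt (EuclideanSpace ℝ (Fin n)) x with hφ'
  have hxφ : x ∈ φ.source := mem_chart_source _ x
  have hφ : IsPartialDiffeo n φ :=
    isPartialDiffeo_of_mem_maximalAtlas (IsManifold.chart_mem_maximalAtlas x)
  have hψ : IsPartialDiffeo n (F.symm ≫ₕ φ) := hF.symm.trans hφ
  have hxt : φ x ∈ (F.symm ≫ₕ φ).target := by
    simp [φ.map_source hxφ, φ.left_inv hxφ, hx]
  have hval : (F.symm ≫ₕ φ) (F x) = φ x := by simp [F.left_inv hx]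
  have hFx : F x ∈ (F.symm ≫ₕ φ).source := by simp [F.map_source hx, F.left_inv hx, hxφ]
  have h1 : inChart φ (pullback F β) =ᶠ[𝓝 (φ x)] inChart (F.symm ≫ₕ φ) β := by
    filter_upwards [(F.symm ≫ₕ φ).open_target.mem_nhds hxt] with z hz
    exact (inChart_symm_trans hF hφ β hz).symm
  have h2 : extDerivForm (pullback F β) x =
      pullback φ (chartExtDeriv (F.symm ≫ₕ φ) β) x := by
    rw [extDerivForm, ← hφ', h1.extDeriv_eq]
    rfl
  have h3 : extDerivForm β (F x) =
      pullback (F.symm ≫ₕ φ) (chartExtDeriv (F.symm ≫ₕ φ) β) (F x) :=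
    extDerivForm_eq_pullback hψ hFx (by rw [hval]; exact hβ.differentiableAt hψ hxt)
  rw [h2, pullback_congr_form h3,
    ← pullback_comp (f := F.symm ≫ₕ φ) (hψ.mdifferentiableAt hFx) (hF.mdifferentiableAt hx)]
  refine pullback_congr_of_eventuallyEq ?_ _
  filter_upwards [F.open_source.mem_nhds hx] with y hy
  simp [F.left_inv hy]

end Pullback

/-! ### The Jacobian of a chart -/

section Jacobian

variable {n : ℕ}
  {M : Type*} [TopologicalSpace M] [ChartedSpace (EuclideanSpace ℝ (Fin n)) M]
  [RiemannianBundle (fun x : M => TangentSpace (𝓡 n) x)]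
  {N : Type*} [TopologicalSpace N] [ChartedSpace (EuclideanSpace ℝ (Fin n)) N]
  [RiemannianBundle (fun x : N => TangentSpace (𝓡 n) x)]
  {φ ψ : OpenPartialHomeomorph M (EuclideanSpace ℝ (Fin n))}

/-- The absolute value of the Jacobian determinant of a map between Riemannian manifolds. -/
def jacobian (f : M → N) (x : M) : ℝ :=
  jac (V := TangentSpace (𝓡 n) x) (W := TangentSpace (𝓡 n) (f x))
    (mfderiv (𝓡 n) (𝓡 n) f x : TangentSpace (𝓡 n) x →L[ℝ] TangentSpace (𝓡 n) (f x)).toLinearMap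

theorem absJacobian_symm_trans {F : OpenPartialHomeomorph M N} (hF : IsPartialDiffeo n F)
    (hφ : IsPartialDiffeo n φ) {z : EuclideanSpace ℝ (Fin n)} (hz : z ∈ (F.symm ≫ₕ φ).target) :
    absJacobian (F.symm ≫ₕ φ) z = jacobian (n := n) F (φ.symm z) * absJacobian φ z := by
  have h : coordVector (F.symm ≫ₕ φ) z = fun i =>
      mfderiv (𝓡 n) (𝓡 n) F (φ.symm z) (coordVector φ z i) :=
    funext fun i => coordVector_symm_trans hF hφ hz i
  rw [absJacobian, h, absJacobian, jacobian]
  exact sqrt_det_gram_map (fact_finrank_tangent (n := n) (φ.symm z)).out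
    (fact_finrank_tangent (n := n) (F (φ.symm z))).out
    (mfderiv (𝓡 n) (𝓡 n) F (φ.symm z)).toLinearMap (coordVector φ z)

theorem coe_basisFun : ⇑(EuclideanSpace.basisFun (Fin n) ℝ) =
    fun i => EuclideanSpace.single i (1 : ℝ) :=
  funext fun i => EuclideanSpace.basisFun_apply (Fin n) ℝ i

theorem sqrt_det_gram_map_single
    (B : EuclideanSpace ℝ (Fin n) →L[ℝ] EuclideanSpace ℝ (Fin n)) :
    √(Matrix.gram ℝ (fun i => B (EuclideanSpace.single i (1 : ℝ)))).det = |B.det| := by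
  have h1 := (EuclideanSpace.basisFun (Fin n) ℝ).toBasis.det_comp B.toLinearMap
    (EuclideanSpace.basisFun (Fin n) ℝ).toBasis
  rw [Basis.det_self, mul_one, OrthonormalBasis.coe_toBasis, coe_basisFun] at h1
  rw [sqrt_det_gram (EuclideanSpace.basisFun (Fin n) ℝ)]
  exact congrArg abs h1

omit [RiemannianBundle (fun x : M => TangentSpace (𝓡 n) x)] in
theorem mfderiv_symm_transition (hφ : IsPartialDiffeo n φ) (hψ : IsPartialDiffeo n ψ)
    {z : EuclideanSpace ℝ (Fin n)} (hz : z ∈ (φ.symm ≫ₕ ψ).source)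
    (w : EuclideanSpace ℝ (Fin n)) :
    (mfderiv (𝓡 n) (𝓡 n) φ.symm z w : EuclideanSpace ℝ (Fin n)) =
      (mfderiv (𝓡 n) (𝓡 n) ψ.symm (ψ (φ.symm z)) : EuclideanSpace ℝ (Fin n) →L[ℝ]
        TangentSpace (𝓡 n) (ψ.symm (ψ (φ.symm z)))) (fderiv ℝ (ψ ∘ φ.symm) z w) := by
  have hz' := hz
  rw [OpenPartialHomeomorph.trans_source] at hz'
  have h1 : HasFDerivAt (ψ ∘ φ.symm) (fderiv ℝ (ψ ∘ φ.symm) z) z :=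
    ((hφ.contDiffAt_transition hψ hz).differentiableAt (by simp)).hasFDerivAt
  have h2 := (eventuallyEq_symm_comp_transition hz).mfderiv_eq (I := 𝓡 n) (I' := 𝓡 n)
  have h3 := mfderiv_comp_apply (I := 𝓡 n) (I' := 𝓡 n) (I'' := 𝓡 n) (f := ψ ∘ φ.symm)
    (g := ψ.symm) z (hψ.symm.mdifferentiableAt (ψ.map_source hz'.2))
    h1.differentiableAt.mdifferentiableAt w
  rw [mfderiv_eq_fderiv] at h3
  exact (congrArg (fun B : EuclideanSpace ℝ (Fin n) →L[ℝ] EuclideanSpace ℝ (Fin n) => B w)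
    h2).trans h3

/-- The change of the Jacobian under a change of charts. -/
theorem absJacobian_transition (hφ : IsPartialDiffeo n φ) (hψ : IsPartialDiffeo n ψ)
    {z : EuclideanSpace ℝ (Fin n)} (hz : z ∈ (φ.symm ≫ₕ ψ).source) :
    absJacobian φ z = |(fderiv ℝ (ψ ∘ φ.symm) z).det| * absJacobian ψ (ψ (φ.symm z)) := by
  have hz' := hz
  rw [OpenPartialHomeomorph.trans_source] at hz'
  set τ := ψ ∘ φ.symm with hτ
  set y := ψ (φ.symm z) with hy
  -- The inner product is written as a function on the fixed model space so that the base points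
  -- `φ.symm z` and `ψ.symm y` can be exchanged by rewriting.
  let b : M → EuclideanSpace ℝ (Fin n) → EuclideanSpace ℝ (Fin n) → ℝ :=
    fun x v w => @inner ℝ (TangentSpace (𝓡 n) x) _ v w
  let A : EuclideanSpace ℝ (Fin n) →L[ℝ] TangentSpace (𝓡 n) (ψ.symm y) :=
    mfderiv (𝓡 n) (𝓡 n) ψ.symm y
  have h1 : ∀ w : EuclideanSpace ℝ (Fin n),
      (mfderiv (𝓡 n) (𝓡 n) φ.symm z w : EuclideanSpace ℝ (Fin n)) = A (fderiv ℝ τ z w) :=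
    mfderiv_symm_transition hφ hψ hz
  have h2 : Matrix.gram ℝ (coordVector φ z) =
      Matrix.gram ℝ (fun i => A (fderiv ℝ τ z (EuclideanSpace.single i 1))) := by
    ext i j
    have hp : φ.symm z = ψ.symm y := (ψ.left_inv hz'.2).symm
    have h3 : b (φ.symm z) (mfderiv (𝓡 n) (𝓡 n) φ.symm z (EuclideanSpace.single i (1 : ℝ)))
        (mfderiv (𝓡 n) (𝓡 n) φ.symm z (EuclideanSpace.single j (1 : ℝ))) =
        b (ψ.symm y) (A (fderiv ℝ τ z (EuclideanSpace.single i 1)))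
          (A (fderiv ℝ τ z (EuclideanSpace.single j 1))) := by
      rw [h1, h1, hp]
    exact h3
  have hE : finrank ℝ (EuclideanSpace ℝ (Fin n)) = n := finrank_euclideanSpace_fin
  have hT : finrank ℝ (TangentSpace (𝓡 n) (ψ.symm y)) = n := finrank_euclideanSpace_fin
  have h4 := sqrt_det_gram_map hE hT A.toLinearMap
    (fun i => fderiv ℝ τ z (EuclideanSpace.single i 1))
  have h5 := sqrt_det_gram_map hE hT A.toLinearMap (fun i => EuclideanSpace.single i (1 : ℝ))
  have h6 : √(Matrix.gram ℝ (fun i : Fin n => EuclideanSpace.single i (1 : ℝ))).det = 1 := by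
    rw [← coe_basisFun, Matrix.gram_eq_one_iff_orthonormal.2 (OrthonormalBasis.orthonormal _),
      Matrix.det_one, Real.sqrt_one]
  rw [h6, mul_one] at h5
  rw [sqrt_det_gram_map_single] at h4
  rw [absJacobian, h2, mul_comm]
  exact h4.trans (congrArg (· * |(fderiv ℝ τ z).det|) h5.symm)

/-- The Jacobian of a chart is positive. -/
theorem absJacobian_pos (hφ : IsPartialDiffeo n φ) {z : EuclideanSpace ℝ (Fin n)}
    (hz : z ∈ φ.target) : 0 < absJacobian φ z := by
  have h1 : LinearIndependent ℝ (coordVector φ z) := by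
    have h2 : LinearIndependent ℝ (fun i : Fin n => EuclideanSpace.single i (1 : ℝ)) := by
      have h3 := (EuclideanSpace.basisFun (Fin n) ℝ).toBasis.linearIndependent
      rwa [OrthonormalBasis.coe_toBasis, coe_basisFun] at h3
    exact h2.map' (mfderiv (𝓡 n) (𝓡 n) φ.symm z).toLinearMap
      (LinearMap.ker_eq_bot.2 (hφ.mdifferentiable.symm.mfderiv_injective hz))
  exact Real.sqrt_pos.2 (Matrix.posDef_gram_of_linearIndependent h1).det_pos

variable [IsManifold (𝓡 n) ∞ M] [IsContMDiffRiemannianBundle (𝓡 n) ∞ (EuclideanSpace ℝ (Fin n))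
      (fun x : M => TangentSpace (𝓡 n) x)]

-- The tangent map of `φ.symm` is continuous, and the coordinate field is its value on a constant
-- section.
omit [RiemannianBundle (fun x : M => TangentSpace (𝓡 n) x)] [IsContMDiffRiemannianBundle (𝓡 n) ∞ (EuclideanSpace ℝ (Fin n))
      (fun x : M => TangentSpace (𝓡 n) x)] in
theorem continuousOn_coordVector (hφ : IsPartialDiffeo n φ) (i : Fin n) :
    ContinuousOn (fun z => (⟨φ.symm z, coordVector φ z i⟩ : TangentBundle (𝓡 n) M)) φ.target := by
  have h1 := hφ.2.continuousOn_tangentMapWithin (by simp) φ.open_target.uniqueMDiffOn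
  have h2 : Continuous (fun z : EuclideanSpace ℝ (Fin n) =>
      (⟨z, EuclideanSpace.single i (1 : ℝ)⟩ : TangentBundle (𝓡 n) (EuclideanSpace ℝ (Fin n)))) :=
    (tangentBundleModelSpaceHomeomorph (𝓡 n)).symm.continuous.comp
      (continuous_id.prodMk continuous_const)
  refine (h1.comp h2.continuousOn fun z hz => hz).congr fun z hz => ?_
  simp only [Function.comp_apply, tangentMapWithin, coordVector,
    mfderivWithin_of_isOpen φ.open_target hz]

theorem continuousOn_absJacobian (hφ : IsPartialDiffeo n φ) :
    ContinuousOn (absJacobian φ) φ.target := by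
  have := isContinuousRiemannianBundle_tangent (n := n) (M := M)
  refine ContinuousOn.sqrt ?_
  have h1 : ContinuousOn (fun z => Matrix.gram ℝ (coordVector φ z)) φ.target := by
    refine continuousOn_pi.2 fun i => continuousOn_pi.2 fun j => ?_
    exact (continuousOn_coordVector hφ i).inner_bundle (continuousOn_coordVector hφ j)
  exact (Continuous.matrix_det continuous_id).comp_continuousOn h1

/-- In a chart `φ` the Jacobian is the quotient of the volume densities of the transported chart
`F.symm ≫ₕ φ` and of `φ`; both are continuous and the denominator is positive. -/
theorem continuous_jacobian [IsManifold (𝓡 n) ∞ N]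
    [IsContMDiffRiemannianBundle (𝓡 n) ∞ (EuclideanSpace ℝ (Fin n))
      (fun x : N => TangentSpace (𝓡 n) x)] {F : OpenPartialHomeomorph M N}
    (hF : IsPartialDiffeo n F) (hs : F.source = univ) : Continuous (jacobian (n := n) F) := by
  refine continuous_iff_continuousAt.2 fun x => ?_
  set φ := chartAt (EuclideanSpace ℝ (Fin n)) x with hφ'
  have hxφ : x ∈ φ.source := mem_chart_source _ x
  have hφ : IsPartialDiffeo n φ :=
    isPartialDiffeo_of_mem_maximalAtlas (IsManifold.chart_mem_maximalAtlas x)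
  have hψ : IsPartialDiffeo n (F.symm ≫ₕ φ) := hF.symm.trans hφ
  have ht : (F.symm ≫ₕ φ).target = φ.target := by simp [hs]
  have h1 : ContinuousOn (fun z => absJacobian (F.symm ≫ₕ φ) z / absJacobian φ z) φ.target :=
    (ht ▸ continuousOn_absJacobian hψ).div (continuousOn_absJacobian hφ)
      fun z hz => (absJacobian_pos hφ hz).ne'
  have h2 : ContinuousOn (jacobian (n := n) F) φ.source := by
    refine (h1.comp φ.continuousOn fun y hy => φ.map_source hy).congr fun y hy => ?_
    have hy' := φ.map_source hy
    simp only [Function.comp_apply]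
    rw [absJacobian_symm_trans hF hφ (ht ▸ hy'), φ.left_inv hy,
      mul_div_cancel_right₀ _ (absJacobian_pos hφ hy').ne']
  exact h2.continuousAt (φ.open_source.mem_nhds hxφ)

end Jacobian

/-! ### The Riemannian measure in charts -/

theorem measurableSet_inter_preimage_of_continuousOn {X Y : Type*} [TopologicalSpace X]
    [MeasurableSpace X] [BorelSpace X] [TopologicalSpace Y] [MeasurableSpace Y] [BorelSpace Y]
    {f : X → Y} {s : Set X} (hf : ContinuousOn f s) (hs : MeasurableSet s) {t : Set Y}
    (ht : MeasurableSet t) : MeasurableSet (s ∩ f ⁻¹' t) := by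
  have h1 : Measurable (s.domRestrict f) := hf.domRestrict.measurable
  have h2 := hs.subtype_image (h1 ht)
  convert h2 using 1
  ext x
  simp only [mem_inter_iff, mem_preimage, mem_image, Subtype.exists, exists_and_right, exists_eq_right]
  exact ⟨fun h => ⟨h.1, h.2⟩, fun ⟨a, b⟩ => ⟨a, b⟩⟩

section Measure

variable {n : ℕ}
  {M : Type*} [TopologicalSpace M] [ChartedSpace (EuclideanSpace ℝ (Fin n)) M]
  [MeasurableSpace M] [BorelSpace M] [RiemannianBundle (fun x : M => TangentSpace (𝓡 n) x)]
  {φ ψ : OpenPartialHomeomorph M (EuclideanSpace ℝ (Fin n))}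

omit [RiemannianBundle (fun x : M => TangentSpace (𝓡 n) x)]
  [ChartedSpace (EuclideanSpace ℝ (Fin n)) M] in
theorem measurableSet_target_inter_preimage
    (φ : OpenPartialHomeomorph M (EuclideanSpace ℝ (Fin n))) {E : Set M} (hE : MeasurableSet E) :
    MeasurableSet (φ.target ∩ φ.symm ⁻¹' E) :=
  measurableSet_inter_preimage_of_continuousOn φ.continuousOn_symm φ.open_target.measurableSet hE

/-- The map `φ.symm` is controlled only on `φ.target`, so it is merely almost everywhere measurable
for the measure concentrated there, and the intersection with `φ.target` has to be inserted. -/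
theorem chartMeasure_apply (φ : OpenPartialHomeomorph M (EuclideanSpace ℝ (Fin n))) {E : Set M}
    (hE : MeasurableSet E) : chartMeasure φ E =
      ∫⁻ z in φ.target ∩ φ.symm ⁻¹' E, ENNReal.ofReal (absJacobian φ z) := by
  have h1 : AEMeasurable φ.symm (volume.restrict φ.target) :=
    φ.continuousOn_symm.aemeasurable φ.open_target.measurableSet
  have h2 : AEMeasurable φ.symm ((volume.restrict φ.target).withDensity
    (fun z => ENNReal.ofReal (absJacobian φ z))) :=
    h1.mono_ac (withDensity_absolutelyContinuous _ _)
  rw [chartMeasure, Measure.map_apply_of_aemeasurable h2 hE]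
  have h3 : φ.symm ⁻¹' E =ᵐ[(volume.restrict φ.target).withDensity
      (fun z => ENNReal.ofReal (absJacobian φ z))] (φ.target ∩ φ.symm ⁻¹' E : Set _) := by
    have h4 : ∀ᵐ z ∂((volume.restrict φ.target).withDensity
      (fun z => ENNReal.ofReal (absJacobian φ z))), z ∈ φ.target :=
      (withDensity_absolutelyContinuous _ _).ae_le (ae_restrict_mem φ.open_target.measurableSet)
    filter_upwards [h4] with z hz
    exact propext ⟨fun h => ⟨hz, h⟩, fun h => h.2⟩
  rw [measure_congr h3, withDensity_apply _ (measurableSet_target_inter_preimage φ hE),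
    Measure.restrict_restrict (measurableSet_target_inter_preimage φ hE),
    inter_assoc, inter_comm (φ.symm ⁻¹' E), ← inter_assoc, inter_self]

theorem chartMeasure_inter_source (φ : OpenPartialHomeomorph M (EuclideanSpace ℝ (Fin n)))
    {E : Set M} (hE : MeasurableSet E) :
    chartMeasure φ (E ∩ φ.source) = chartMeasure φ E := by
  rw [chartMeasure_apply φ hE, chartMeasure_apply φ (hE.inter φ.open_source.measurableSet)]
  congr 2
  ext z
  simp only [mem_inter_iff, mem_preimage]
  exact ⟨fun h => ⟨h.1, h.2.1⟩, fun h => ⟨h.1, h.2, φ.map_target h.1⟩⟩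

/-- The measures defined by two charts agree on their common domain. -/
theorem chartMeasure_congr (hφ : IsPartialDiffeo n φ) (hψ : IsPartialDiffeo n ψ) {E : Set M}
    (hE : MeasurableSet E) (hEφ : E ⊆ φ.source) (hEψ : E ⊆ ψ.source) :
    chartMeasure φ E = chartMeasure ψ E := by
  rw [chartMeasure_apply φ hE, chartMeasure_apply ψ hE]
  set S := φ.target ∩ φ.symm ⁻¹' E with hS
  have hSs : S ⊆ (φ.symm ≫ₕ ψ).source := fun z hz => by
    rw [OpenPartialHomeomorph.trans_source]
    exact ⟨hz.1, hEψ hz.2⟩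
  have himg : (ψ ∘ φ.symm) '' S = ψ.target ∩ ψ.symm ⁻¹' E := by
    ext w
    constructor
    · rintro ⟨z, hz, rfl⟩
      refine ⟨ψ.map_source (hEψ hz.2), ?_⟩
      simp only [mem_preimage, Function.comp_apply, ψ.left_inv (hEψ hz.2)]
      exact hz.2
    · rintro ⟨hw, hwE⟩
      refine ⟨φ (ψ.symm w), ⟨φ.map_source (hEφ hwE), ?_⟩, ?_⟩
      · simp only [mem_preimage, φ.left_inv (hEφ hwE)]
        exact hwE
      · simp only [Function.comp_apply, φ.left_inv (hEφ hwE), ψ.right_inv hw]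
  -- The Jacobian determinant of the transition map is exactly the ratio of the two densities.
  rw [← himg, lintegral_image_eq_lintegral_abs_det_fderiv_mul volume
    (measurableSet_target_inter_preimage φ hE) (f' := fun z => fderiv ℝ (ψ ∘ φ.symm) z)
    (fun z hz => ((hφ.contDiffAt_transition hψ (hSs hz)).differentiableAt
      (by simp)).hasFDerivAt.hasFDerivWithinAt)
    ((φ.symm ≫ₕ ψ).injOn.mono hSs)]
  refine setLIntegral_congr_fun (measurableSet_target_inter_preimage φ hE) fun z hz => ?_
  rw [absJacobian_transition hφ hψ (hSs hz), ENNReal.ofReal_mul (abs_nonneg _)]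
  rfl

variable [SecondCountableTopology M] [IsManifold (𝓡 n) ∞ M]

omit [MeasurableSpace M] [BorelSpace M] [RiemannianBundle (fun x : M => TangentSpace (𝓡 n) x)]
  [IsManifold (𝓡 n) ∞ M] in
variable (n M) in
theorem exists_seq_chartAt_cover [Nonempty M] :
    ∃ u : ℕ → M, ⋃ i, (chartAt (EuclideanSpace ℝ (Fin n)) (u i)).source = univ := by
  obtain ⟨s, hs, hsu⟩ := TopologicalSpace.countable_cover_nhds
    (chart_source_mem_nhds (H := EuclideanSpace ℝ (Fin n)) (M := M))
  have hne : s.Nonempty := by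
    by_contra h
    rw [not_nonempty_iff_eq_empty] at h
    rw [h, biUnion_empty] at hsu
    exact empty_ne_univ hsu
  obtain ⟨u, rfl⟩ := hs.exists_eq_range hne
  exact ⟨u, by rwa [biUnion_range] at hsu⟩

/-- On the domain of a smooth chart the Riemannian measure is the measure defined by the chart. -/
theorem riemannianMeasure_apply (hφ : IsPartialDiffeo n φ) {E : Set M} (hE : MeasurableSet E)
    (hEφ : E ⊆ φ.source) : riemannianMeasure n M E = chartMeasure φ E := by
  refine le_antisymm ?_ (Measure.le_iff'.1 (le_iSup₂_of_le φ hφ.mem_maximalAtlas le_rfl) E)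
  rcases isEmpty_or_nonempty M with hM | hM
  · rw [Set.eq_empty_of_isEmpty E]; simp
  obtain ⟨u, hu⟩ := exists_seq_chartAt_cover n M
  let c : ℕ → OpenPartialHomeomorph M (EuclideanSpace ℝ (Fin n)) :=
    fun i => chartAt (EuclideanSpace ℝ (Fin n)) (u i)
  have hc : ∀ i, IsPartialDiffeo n (c i) := fun i =>
    isPartialDiffeo_of_mem_maximalAtlas (IsManifold.chart_mem_maximalAtlas (u i))
  -- Countably many chart domains are made disjoint and the chart measures are glued to `ν`. Since
  -- chart measures agree on overlaps, `ν` restricts to each of them, so it dominates their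
  -- supremum.
  let D : ℕ → Set M := disjointed fun i => (c i).source
  have hD : ∀ i, MeasurableSet (D i) :=
    fun i => MeasurableSet.disjointed (fun i => (c i).open_source.measurableSet) i
  have hDu : ⋃ i, D i = univ := by rw [iUnion_disjointed]; exact hu
  have hDd : Pairwise (Function.onFun Disjoint D) := disjoint_disjointed _
  have hDs : ∀ i, D i ⊆ (c i).source := fun i => disjointed_subset _ i
  let ν : Measure M := Measure.sum fun i => (chartMeasure (c i)).restrict (D i)
  have hν : ∀ χ : OpenPartialHomeomorph M (EuclideanSpace ℝ (Fin n)), IsPartialDiffeo n χ →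
      ∀ A, MeasurableSet A → A ⊆ χ.source → ν A = chartMeasure χ A := by
    intro χ hχ A hA hAχ
    have h1 : A = ⋃ i, A ∩ D i := by rw [← inter_iUnion, hDu, inter_univ]
    conv_rhs => rw [h1]
    rw [measure_iUnion (fun i j hij => (hDd hij).mono inter_subset_right inter_subset_right)
      (fun i => hA.inter (hD i)), Measure.sum_apply _ hA]
    refine tsum_congr fun i => ?_
    rw [Measure.restrict_apply hA]
    exact chartMeasure_congr (hc i) hχ (hA.inter (hD i)) (inter_subset_right.trans (hDs i))
      (inter_subset_left.trans hAχ)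
  have hle : riemannianMeasure n M ≤ ν := by
    refine iSup₂_le fun χ hχ => Measure.le_iff.2 fun A hA => ?_
    have hχ' := isPartialDiffeo_of_mem_maximalAtlas hχ
    rw [← chartMeasure_inter_source χ hA,
      ← hν χ hχ' _ (hA.inter χ.open_source.measurableSet) inter_subset_right]
    exact measure_mono inter_subset_left
  exact (Measure.le_iff'.1 hle E).trans_eq (hν φ hφ E hE hEφ)

end Measure

/-! ### Change of variables for the Riemannian measure. -/

section ChangeOfVariables

variable {n : ℕ}
  {M : Type*} [TopologicalSpace M] [SecondCountableTopology M]
  [ChartedSpace (EuclideanSpace ℝ (Fin n)) M] [IsManifold (𝓡 n) ∞ M]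
  [MeasurableSpace M] [BorelSpace M] [RiemannianBundle (fun x : M => TangentSpace (𝓡 n) x)]
  [IsContMDiffRiemannianBundle (𝓡 n) ∞ (EuclideanSpace ℝ (Fin n))
      (fun x : M => TangentSpace (𝓡 n) x)]
  {N : Type*} [TopologicalSpace N] [SecondCountableTopology N]
  [ChartedSpace (EuclideanSpace ℝ (Fin n)) N] [IsManifold (𝓡 n) ∞ N]
  [MeasurableSpace N] [BorelSpace N] [RiemannianBundle (fun x : N => TangentSpace (𝓡 n) x)]
  [IsContMDiffRiemannianBundle (𝓡 n) ∞ (EuclideanSpace ℝ (Fin n))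
      (fun x : N => TangentSpace (𝓡 n) x)]

omit [SecondCountableTopology M] [IsManifold (𝓡 n) ∞ M]
  [IsContMDiffRiemannianBundle (𝓡 n) ∞ (EuclideanSpace ℝ (Fin n))
      (fun x : M => TangentSpace (𝓡 n) x)] in
theorem lintegral_chartMeasure (φ : OpenPartialHomeomorph M (EuclideanSpace ℝ (Fin n)))
    (hφ : ContinuousOn (absJacobian φ) φ.target) {g : M → ℝ≥0∞} (hg : Measurable g) :
    ∫⁻ x, g x ∂chartMeasure φ =
      ∫⁻ z in φ.target, ENNReal.ofReal (absJacobian φ z) * g (φ.symm z) := by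
  have h1 : AEMeasurable φ.symm (volume.restrict φ.target) :=
    φ.continuousOn_symm.aemeasurable φ.open_target.measurableSet
  have h2 : AEMeasurable φ.symm ((volume.restrict φ.target).withDensity
    (fun z => ENNReal.ofReal (absJacobian φ z))) :=
    h1.mono_ac (withDensity_absolutelyContinuous _ _)
  rw [chartMeasure, lintegral_map' hg.aemeasurable h2]
  exact lintegral_withDensity_eq_lintegral_mul₀
    (hφ.aemeasurable φ.open_target.measurableSet).ennreal_ofReal (hg.comp_aemeasurable h1)

theorem measurableEmbedding_of_isPartialDiffeo {X Y : Type*} [TopologicalSpace X]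
    [MeasurableSpace X] [BorelSpace X] [TopologicalSpace Y] [MeasurableSpace Y] [BorelSpace Y]
    {F : OpenPartialHomeomorph X Y} (hs : F.source = univ) : MeasurableEmbedding F :=
  (F.isOpenEmbedding hs).measurableEmbedding

/-- The change of variables formula for the Riemannian measure. -/
theorem comap_riemannianMeasure {F : OpenPartialHomeomorph M N} (hF : IsPartialDiffeo n F)
    (hs : F.source = univ) :
    (riemannianMeasure n N).comap F =
      (riemannianMeasure n M).withDensity fun x => ENNReal.ofReal (jacobian (n := n) F x) := by
  rcases isEmpty_or_nonempty M with hM | hM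
  · exact Subsingleton.elim _ _
  have hFe := measurableEmbedding_of_isPartialDiffeo hs
  have hJ : Measurable fun x => ENNReal.ofReal (jacobian (n := n) F x) :=
    (continuous_jacobian hF hs).measurable.ennreal_ofReal
  obtain ⟨u, hu⟩ := exists_seq_chartAt_cover n M
  refine Measure.ext_of_iUnion_eq_univ hu fun i => ?_
  set φ := chartAt (EuclideanSpace ℝ (Fin n)) (u i)
  have hφ : IsPartialDiffeo n φ :=
    isPartialDiffeo_of_mem_maximalAtlas (IsManifold.chart_mem_maximalAtlas (u i))
  have hψ : IsPartialDiffeo n (F.symm ≫ₕ φ) := hF.symm.trans hφ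
  have ht : (F.symm ≫ₕ φ).target = φ.target := by simp [hs]
  have hmφ : (riemannianMeasure n M).restrict φ.source = chartMeasure φ := by
    ext A hA
    rw [Measure.restrict_apply hA, riemannianMeasure_apply hφ
      (hA.inter φ.open_source.measurableSet) inter_subset_right, chartMeasure_inter_source φ hA]
  ext A hA
  have hAφ : MeasurableSet (A ∩ φ.source) := hA.inter φ.open_source.measurableSet
  have hsub : F '' (A ∩ φ.source) ⊆ (F.symm ≫ₕ φ).source := by
    rintro _ ⟨x, hx, rfl⟩
    have hxs : x ∈ F.source := hs ▸ mem_univ x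
    rw [OpenPartialHomeomorph.trans_source]
    exact ⟨F.map_source hxs, by simpa only [mem_preimage, F.left_inv hxs] using hx.2⟩
  -- The chart `φ` and its transport to `N` use the same coordinates, so both measures become
  -- integrals over the same set and only the densities differ, by the factor `jacobian`.
  have hset : (F.symm ≫ₕ φ).target ∩ (F.symm ≫ₕ φ).symm ⁻¹' (F '' (A ∩ φ.source)) =
      φ.target ∩ φ.symm ⁻¹' A := by
    rw [ht]
    ext z
    refine and_congr_right fun hz => ?_
    change F (φ.symm z) ∈ F '' (A ∩ φ.source) ↔ φ.symm z ∈ A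
    rw [hFe.injective.mem_set_image]
    exact ⟨fun h => h.1, fun h => ⟨h, φ.map_target hz⟩⟩
  rw [Measure.restrict_apply hA, Measure.restrict_apply hA, hFe.comap_apply,
    withDensity_apply _ hAφ, ← Measure.restrict_restrict hA, hmφ,
    riemannianMeasure_apply hψ (hFe.measurableSet_image' hAφ) hsub,
    chartMeasure_apply _ (hFe.measurableSet_image' hAφ), hset, ← lintegral_indicator hA,
    lintegral_chartMeasure φ (continuousOn_absJacobian hφ) (hJ.indicator hA),
    ← lintegral_indicator (measurableSet_target_inter_preimage φ hA),
    ← lintegral_indicator φ.open_target.measurableSet]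
  refine lintegral_congr fun z => ?_
  by_cases hz : z ∈ φ.target
  · by_cases hzA : φ.symm z ∈ A
    · rw [indicator_of_mem (show z ∈ φ.target ∩ φ.symm ⁻¹' A from ⟨hz, hzA⟩),
        indicator_of_mem hz, indicator_of_mem hzA, absJacobian_symm_trans hF hφ (ht ▸ hz),
        mul_comm, ENNReal.ofReal_mul (absJacobian_pos hφ hz).le]
    · rw [indicator_of_notMem (fun h => hzA h.2), indicator_of_mem hz,
        indicator_of_notMem hzA, mul_zero]
  · rw [indicator_of_notMem (fun h => hz h.1), indicator_of_notMem hz]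

theorem restrict_riemannianMeasure_target {F : OpenPartialHomeomorph M N}
    (hF : IsPartialDiffeo n F) (hs : F.source = univ) :
    (riemannianMeasure n N).restrict F.target =
      ((riemannianMeasure n M).withDensity
        fun x => ENNReal.ofReal (jacobian (n := n) F x)).map F := by
  have hFe := measurableEmbedding_of_isPartialDiffeo hs
  have hr : range F = F.target := by
    rw [← image_univ, ← hs, F.image_source_eq_target]
  rw [← comap_riemannianMeasure hF hs, hFe.map_comap, hr]

/-- A map that contracts lengths at most by `L⁻¹` contracts the Riemannian measure at most by
`L⁻ⁿ`. -/
theorem map_riemannianMeasure_le {F : OpenPartialHomeomorph M N} (hF : IsPartialDiffeo n F)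
    (hs : F.source = univ) {L : ℝ} (hL : 0 < L)
    (hA : ∀ (x : M) (v : TangentSpace (𝓡 n) x), L⁻¹ * ‖v‖ ≤ ‖mfderiv (𝓡 n) (𝓡 n) F x v‖) :
    (riemannianMeasure n M).map F ≤ ENNReal.ofReal (L ^ n) • riemannianMeasure n N := by
  have hFe := measurableEmbedding_of_isPartialDiffeo hs
  have h1 : riemannianMeasure n M ≤ ENNReal.ofReal (L ^ n) • (riemannianMeasure n N).comap F := by
    rw [comap_riemannianMeasure hF hs]
    refine Measure.le_iff.2 fun E hE => ?_
    rw [Measure.smul_apply, withDensity_apply _ hE, smul_eq_mul,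
      ← lintegral_const_mul' _ _ ENNReal.ofReal_ne_top, ← setLIntegral_one]
    refine setLIntegral_mono' hE fun x _ => ?_
    rw [← ENNReal.ofReal_mul (by positivity), ENNReal.one_le_ofReal]
    exact one_le_pow_mul_jac (fact_finrank_tangent (n := n) x).out
      (fact_finrank_tangent (n := n) (F x)).out (mfderiv (𝓡 n) (𝓡 n) F x).toLinearMap hL (hA x)
  refine (Measure.map_mono h1 hFe.measurable).trans ?_
  rw [Measure.map_smul, hFe.map_comap]
  exact Measure.le_iff.2 fun E hE => by
    simp only [Measure.smul_apply, smul_eq_mul]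
    exact mul_le_mul_right (Measure.restrict_le_self E) _

end ChangeOfVariables

/-! ### Orientations and partial diffeomorphisms -/

theorem alternatingMap_apply_map_single {n : ℕ}
    (β : EuclideanSpace ℝ (Fin n) [⋀^Fin n]→ₗ[ℝ] ℝ)
    (B : EuclideanSpace ℝ (Fin n) →L[ℝ] EuclideanSpace ℝ (Fin n)) :
    β (fun i => B (EuclideanSpace.single i (1 : ℝ))) =
      B.det * β (fun i => EuclideanSpace.single i (1 : ℝ)) := by
  let b := EuclideanSpace.basisFun (Fin n) ℝ
  have hb : ⇑b = fun i => EuclideanSpace.single i (1 : ℝ) := coe_basisFun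
  have h1 := b.toBasis.det_comp B.toLinearMap b.toBasis
  rw [Basis.det_self, mul_one, OrthonormalBasis.coe_toBasis, hb] at h1
  have h2 := congrArg (fun f : EuclideanSpace ℝ (Fin n) [⋀^Fin n]→ₗ[ℝ] ℝ =>
    f fun i => B (EuclideanSpace.single i (1 : ℝ))) (β.eq_smul_basis_det b.toBasis)
  simp only [AlternatingMap.smul_apply, smul_eq_mul, OrthonormalBasis.coe_toBasis, hb] at h2
  rw [h2, mul_comm]
  exact congrArg (· * _) h1

section Sign

variable {n : ℕ}
  {M : Type*} [TopologicalSpace M] [ChartedSpace (EuclideanSpace ℝ (Fin n)) M]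
  [RiemannianBundle (fun x : M => TangentSpace (𝓡 n) x)]
  {N : Type*} [TopologicalSpace N] [ChartedSpace (EuclideanSpace ℝ (Fin n)) N]
  [RiemannianBundle (fun x : N => TangentSpace (𝓡 n) x)]

/-- The signed version of `absJacobian_transition`: the two coordinate frames differ by the
derivative of the transition map, and a form of top degree picks up its determinant. -/
theorem volumeForm_coordVector_transition (o : ManifoldOrientation n M)
    {φ ψ : OpenPartialHomeomorph M (EuclideanSpace ℝ (Fin n))}
    (hφ : IsPartialDiffeo n φ) (hψ : IsPartialDiffeo n ψ)
    {z : EuclideanSpace ℝ (Fin n)} (hz : z ∈ (φ.symm ≫ₕ ψ).source) :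
    (o.orient (φ.symm z)).volumeForm (coordVector φ z) = (fderiv ℝ (ψ ∘ φ.symm) z).det *
      (o.orient (ψ.symm (ψ (φ.symm z)))).volumeForm (coordVector ψ (ψ (φ.symm z))) := by
  have hz' := hz
  rw [OpenPartialHomeomorph.trans_source] at hz'
  let b : M → (Fin n → EuclideanSpace ℝ (Fin n)) → ℝ := fun x v =>
    (o.orient x).volumeForm (v : Fin n → TangentSpace (𝓡 n) x)
  let A : EuclideanSpace ℝ (Fin n) →L[ℝ] EuclideanSpace ℝ (Fin n) :=
    mfderiv (𝓡 n) (𝓡 n) ψ.symm (ψ (φ.symm z))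
  have h1 : b (φ.symm z) (coordVector φ z) = b (ψ.symm (ψ (φ.symm z)))
      (fun i => A (fderiv ℝ (ψ ∘ φ.symm) z (EuclideanSpace.single i 1))) := by
    have h2 : coordVector φ z =
        fun i => A (fderiv ℝ (ψ ∘ φ.symm) z (EuclideanSpace.single i 1)) :=
      funext fun i => mfderiv_symm_transition hφ hψ hz _
    rw [h2, ψ.left_inv hz'.2]
  refine h1.trans ?_
  exact alternatingMap_apply_map_single
    (AlternatingMap.compLinearMap (M₂ := EuclideanSpace ℝ (Fin n))
      (o.orient (ψ.symm (ψ (φ.symm z)))).volumeForm A.toLinearMap) (fderiv ℝ (ψ ∘ φ.symm) z)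

/-- The sign of the Jacobian determinant of a map between oriented manifolds. -/
def jacobianSign (oM : ManifoldOrientation n M) (oN : ManifoldOrientation n N) (f : M → N)
    (x : M) : ℝ :=
  SignType.sign (signedJac (oM.orient x) (oN.orient (f x)) (mfderiv (𝓡 n) (𝓡 n) f x).toLinearMap)

variable [IsManifold (𝓡 n) ∞ M] {F : OpenPartialHomeomorph M N}

theorem jacobian_pos (hF : IsPartialDiffeo n F) {x : M} (hx : x ∈ F.source) :
    0 < jacobian (n := n) F x := by
  set φ := chartAt (EuclideanSpace ℝ (Fin n)) x
  have hxφ : x ∈ φ.source := mem_chart_source _ x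
  have hφ : IsPartialDiffeo n φ :=
    isPartialDiffeo_of_mem_maximalAtlas (IsManifold.chart_mem_maximalAtlas x)
  have hz : φ x ∈ (F.symm ≫ₕ φ).target := by simp [φ.map_source hxφ, φ.left_inv hxφ, hx]
  have h1 := absJacobian_symm_trans hF hφ hz
  rw [φ.left_inv hxφ] at h1
  exact pos_of_mul_pos_left (h1 ▸ absJacobian_pos (hF.symm.trans hφ) hz)
    (absJacobian_pos hφ (φ.map_source hxφ)).le

variable (oM : ManifoldOrientation n M) (oN : ManifoldOrientation n N)

theorem signedJac_ne_zero (hF : IsPartialDiffeo n F) {x : M} (hx : x ∈ F.source) :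
    signedJac (oM.orient x) (oN.orient (F x)) (mfderiv (𝓡 n) (𝓡 n) F x).toLinearMap ≠ 0 := by
  rw [← abs_pos, abs_signedJac]
  exact jacobian_pos hF hx

theorem jacobianSign_mul_self (hF : IsPartialDiffeo n F) {x : M} (hx : x ∈ F.source) :
    jacobianSign oM oN F x * jacobianSign oM oN F x = 1 := by
  rcases lt_or_gt_of_ne (signedJac_ne_zero oM oN hF hx) with h | h
  · simp [jacobianSign, sign_neg h]
  · simp [jacobianSign, sign_pos h]

omit [IsManifold (𝓡 n) ∞ M] in
theorem jacobianSign_mul_signedJac (x : M) :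
    jacobianSign oM oN F x *
      signedJac (oM.orient x) (oN.orient (F x)) (mfderiv (𝓡 n) (𝓡 n) F x).toLinearMap =
        jacobian (n := n) F x := by
  rw [jacobianSign, sign_mul_self, abs_signedJac]
  rfl

variable [IsManifold (𝓡 n) ∞ N]

/-- In positively oriented charts the sign is that of the Jacobian determinant of the coordinate
expression, a continuous function without zeros. -/
theorem jacobianSign_eventually_eq (hF : IsPartialDiffeo n F) {x : M} (hx : x ∈ F.source) :
    ∀ᶠ y in 𝓝 x, jacobianSign oM oN F y = jacobianSign oM oN F x := by
  obtain ⟨φ, hφa, hxφ, hφp⟩ := oM.exists_chart x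
  obtain ⟨ψ, hψa, hxψ, hψp⟩ := oN.exists_chart (F x)
  have hφ := isPartialDiffeo_of_mem_maximalAtlas hφa
  have hψ := isPartialDiffeo_of_mem_maximalAtlas hψa
  have hχ : IsPartialDiffeo n (F.symm ≫ₕ φ) := hF.symm.trans hφ
  set τ := (F.symm ≫ₕ φ).symm ≫ₕ ψ with hτ
  have hzt : φ x ∈ τ.source := by
    simp [hτ, φ.map_source hxφ, φ.left_inv hxφ, hx, hxψ]
  let g : EuclideanSpace ℝ (Fin n) → ℝ := fun z => (fderiv ℝ (ψ ∘ (F.symm ≫ₕ φ).symm) z).det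
  have hsign : ∀ z ∈ τ.source, g z ≠ 0 ∧ jacobianSign oM oN F (φ.symm z) = SignType.sign (g z) := by
    intro z hz
    have hzχ : z ∈ (F.symm ≫ₕ φ).target := by
      rw [hτ, OpenPartialHomeomorph.trans_source] at hz
      exact hz.1
    have hzψ : F (φ.symm z) ∈ ψ.source := by
      rw [hτ, OpenPartialHomeomorph.trans_source] at hz
      exact hz.2
    rw [OpenPartialHomeomorph.trans_target] at hzχ
    -- The volume of the frame transported to `N` is computed twice: `h1` gives `g z` times a
    -- positive number, `h2` the signed Jacobian times a positive number.
    have h1 := volumeForm_coordVector_transition oN hχ hψ hz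
    have h2 : (oN.orient ((F.symm ≫ₕ φ).symm z)).volumeForm (coordVector (F.symm ≫ₕ φ) z) =
        signedJac (oM.orient (φ.symm z)) (oN.orient (F (φ.symm z)))
          (mfderiv (𝓡 n) (𝓡 n) F (φ.symm z)).toLinearMap *
            (oM.orient (φ.symm z)).volumeForm (coordVector φ z) := by
      have h3 : coordVector (F.symm ≫ₕ φ) z = fun i =>
          mfderiv (𝓡 n) (𝓡 n) F (φ.symm z) (coordVector φ z i) :=
        funext fun i => coordVector_symm_trans hF hφ hzχ i
      rw [h3, signedJac_mul_volumeForm]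
      rfl
    have h4 := hφp z hzχ.1
    have h5 : 0 < (oN.orient (ψ.symm (ψ ((F.symm ≫ₕ φ).symm z)))).volumeForm
        (coordVector ψ (ψ ((F.symm ≫ₕ φ).symm z))) := hψp _ (ψ.map_source hzψ)
    have h6 := h2.symm.trans h1
    have h7 : signedJac (oM.orient (φ.symm z)) (oN.orient (F (φ.symm z)))
          (mfderiv (𝓡 n) (𝓡 n) F (φ.symm z)).toLinearMap ≠ 0 :=
      signedJac_ne_zero oM oN hF hzχ.2
    refine ⟨fun h => ?_, ?_⟩
    · rw [show (fderiv ℝ (ψ ∘ (F.symm ≫ₕ φ).symm) z).det = 0 from h, zero_mul] at h6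
      exact (mul_ne_zero h7 h4.ne') h6
    · have h8 := congrArg (fun r : ℝ => ((SignType.sign r : SignType) : ℝ)) h6
      simp only [sign_mul, sign_pos h4, sign_pos h5, mul_one] at h8
      exact h8
  have hg : ContinuousAt g (φ x) := by
    have h1 := (hχ.contDiffAt_transition hψ hzt).fderiv_right (m := 0) (by simp)
    exact (ContinuousLinearMap.continuous_det).continuousAt.comp h1.continuousAt
  have hgs : ∀ᶠ z in 𝓝 (φ x), SignType.sign (g z) = SignType.sign (g (φ x)) := by
    rcases lt_or_gt_of_ne (hsign _ hzt).1 with h | h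
    · filter_upwards [hg.eventually_lt continuousAt_const h] with z hz
      rw [sign_neg h, sign_neg hz]
    · filter_upwards [continuousAt_const.eventually_lt hg h] with z hz
      rw [sign_pos h, sign_pos hz]
  have h1 : ∀ᶠ y in 𝓝 x, SignType.sign (g (φ y)) = SignType.sign (g (φ x)) :=
    (φ.continuousAt hxφ).eventually hgs
  have h2 : ∀ᶠ y in 𝓝 x, φ y ∈ τ.source :=
    (φ.continuousAt hxφ).eventually (τ.open_source.mem_nhds hzt)
  filter_upwards [h1, h2, φ.open_source.mem_nhds hxφ] with y hy1 hy2 hy3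
  have h3 := (hsign _ hy2).2
  have h4 := (hsign _ hzt).2
  rw [φ.left_inv hy3] at h3
  rw [φ.left_inv hxφ] at h4
  rw [h3, h4, hy1]

end Sign

/-! ### Transport of test forms -/

section PushForward

variable {n : ℕ}
  {M : Type*} [TopologicalSpace M] [ChartedSpace (EuclideanSpace ℝ (Fin n)) M]
  [RiemannianBundle (fun x : M => TangentSpace (𝓡 n) x)]
  {N : Type*} [TopologicalSpace N] [ChartedSpace (EuclideanSpace ℝ (Fin n)) N]
  [RiemannianBundle (fun x : N => TangentSpace (𝓡 n) x)] {k : ℕ}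
  (oM : ManifoldOrientation n M) (oN : ManifoldOrientation n N) {F : OpenPartialHomeomorph M N}

open Classical in
/-- The push-forward of a form by a partial diffeomorphism, extended by zero and multiplied by the
sign of the Jacobian determinant. -/
def signedPushforward (F : OpenPartialHomeomorph M N) (η : DiffForm n M k) : DiffForm n N k :=
  fun y => if y ∈ F.target then jacobianSign oM oN F (F.symm y) • pullback F.symm η y else 0

omit [RiemannianBundle (fun x : M => TangentSpace (𝓡 n) x)]
  [RiemannianBundle (fun x : N => TangentSpace (𝓡 n) x)] in
theorem pullback_symm_comp_self (hF : IsPartialDiffeo n F) (η : DiffForm n M k) {x : M}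
    (hx : x ∈ F.source) : pullback F (pullback F.symm η) x = η x := by
  have h : F.symm ∘ F =ᶠ[𝓝 x] id := by
    filter_upwards [F.open_source.mem_nhds hx] with y hy using F.left_inv hy
  rw [← pullback_comp (hF.symm.mdifferentiableAt (F.map_source hx)) (hF.mdifferentiableAt hx),
    pullback_congr_of_eventuallyEq h]
  ext v
  rw [pullback_apply_apply, mfderiv_id]
  rfl

theorem pullback_signedPushforward (hF : IsPartialDiffeo n F) (η : DiffForm n M k) {x : M}
    (hx : x ∈ F.source) :
    pullback F (signedPushforward oM oN F η) x = jacobianSign oM oN F x • η x := by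
  have h : signedPushforward oM oN F η (F x) =
      jacobianSign oM oN F x • pullback F.symm η (F x) := by
    rw [signedPushforward, if_pos (F.map_source hx), F.left_inv hx]
  rw [pullback_congr_form (β := fun y => jacobianSign oM oN F x • pullback F.symm η y) h,
    pullback_smul F (fun _ => jacobianSign oM oN F x), pullback_symm_comp_self hF η hx]

theorem signedPushforward_eq_zero {η : DiffForm n M k} {y : N}
    (hy : y ∉ F '' closure {x | η x ≠ 0}) : signedPushforward oM oN F η y = 0 := by
  by_cases hyt : y ∈ F.target
  · have h : η (F.symm y) = 0 := by
      by_contra h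
      exact hy ⟨F.symm y, subset_closure h, F.right_inv hyt⟩
    rw [signedPushforward, if_pos hyt, pullback, h]
    ext v
    simp
  · rw [signedPushforward, if_neg hyt]

omit [RiemannianBundle (fun x : M => TangentSpace (𝓡 n) x)]
  [RiemannianBundle (fun x : N => TangentSpace (𝓡 n) x)] [ChartedSpace (EuclideanSpace ℝ (Fin n)) N] in
theorem isCompact_image_support (hs : F.source = univ) {η : DiffForm n M k} (hη : IsTestForm η) :
    IsCompact (F '' closure {x | η x ≠ 0}) :=
  hη.2.image_of_continuousOn (F.continuousOn.mono (hs ▸ subset_univ _))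

/-- The top-degree form `α ∧ β` is pulled back with the signed Jacobian, and the extra sign makes it
the absolute value, which is the density in the change of variables. -/
theorem volCoeff_wedge_pullback {l : ℕ} (h : k + l = n) (α : DiffForm n N k) (β : DiffForm n N l) (x : M) :
    volCoeff (oM.orient x) (wedge h (pullback F α x).toAlternatingMap
      (jacobianSign oM oN F x • pullback F β x).toAlternatingMap) =
    jacobian (n := n) F x * volCoeff (oN.orient (F x))
      (wedge h (α (F x)).toAlternatingMap (β (F x)).toAlternatingMap) := by
  have h1 := wedge_compLinearMap h (α (F x)).toAlternatingMap (β (F x)).toAlternatingMap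
    (mfderiv (𝓡 n) (𝓡 n) F x).toLinearMap
  have h2 := wedge_smul_right h (pullback F α x).toAlternatingMap
    (pullback F β x).toAlternatingMap (jacobianSign oM oN F x)
  have h3 := volCoeff_compLinearMap (oM.orient x) (oN.orient (F x))
    (mfderiv (𝓡 n) (𝓡 n) F x).toLinearMap
    (wedge h (α (F x)).toAlternatingMap (β (F x)).toAlternatingMap)
  have h4 : volCoeff (oM.orient x) (wedge h (pullback F α x).toAlternatingMap
      (pullback F β x).toAlternatingMap) = _ := (congrArg (volCoeff (oM.orient x)) h1).trans h3
  refine (congrArg (volCoeff (oM.orient x)) h2).trans ?_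
  rw [volCoeff_smul, h4, ← jacobianSign_mul_signedJac oM oN]
  ring

variable [IsManifold (𝓡 n) ∞ M]

theorem eq_smul_pullback_signedPushforward (hF : IsPartialDiffeo n F) (η : DiffForm n M k) {x : M}
    (hx : x ∈ F.source) :
    η x = jacobianSign oM oN F x • pullback F (signedPushforward oM oN F η) x := by
  rw [pullback_signedPushforward oM oN hF η hx, smul_smul, jacobianSign_mul_self oM oN hF hx,
    one_smul]

variable [IsManifold (𝓡 n) ∞ N]

-- Measurability is tested in all smooth charts, and a chart `φ` of `M` corresponds to the chart
-- `F.symm ≫ₕ φ` of `N` with the same target.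
omit [RiemannianBundle (fun x : M => TangentSpace (𝓡 n) x)]
  [RiemannianBundle (fun x : N => TangentSpace (𝓡 n) x)] in
theorem IsMeasurableForm.pullback (hF : IsPartialDiffeo n F) (hs : F.source = univ)
    {α : DiffForm n N k} (hα : IsMeasurableForm α) : IsMeasurableForm (pullback F α) := by
  intro φ hφ v
  have ht : (F.symm ≫ₕ φ).target = φ.target := by simp [hs]
  have h := hα _ (hF.symm_trans_mem_maximalAtlas hφ) v
  rw [ht] at h
  refine h.congr ?_
  filter_upwards [ae_restrict_mem φ.open_target.measurableSet] with z hz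
  rw [inChart_symm_trans hF (isPartialDiffeo_of_mem_maximalAtlas hφ) α (ht ▸ hz)]

variable [T2Space N]

omit [IsManifold (𝓡 n) ∞ M] [IsManifold (𝓡 n) ∞ N] in
theorem signedPushforward_eventually_eq_zero (hs : F.source = univ) {η : DiffForm n M k}
    (hη : IsTestForm η) {y : N} (hy : y ∉ F '' closure {x | η x ≠ 0}) :
    ∀ᶠ y' in 𝓝 y, signedPushforward oM oN F η y' = 0 := by
  filter_upwards [(isCompact_image_support hs hη).isClosed.isOpen_compl.mem_nhds hy] with y' hy'
  exact signedPushforward_eq_zero oM oN hy'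

omit [IsManifold (𝓡 n) ∞ M] [IsManifold (𝓡 n) ∞ N] in
theorem extDerivForm_signedPushforward_eq_zero (hs : F.source = univ) {η : DiffForm n M k}
    (hη : IsTestForm η) {y : N} (hy : y ∉ F.target) :
    extDerivForm (signedPushforward oM oN F η) y = 0 := by
  have hy' : y ∉ F '' closure {x | η x ≠ 0} := by
    rintro ⟨x, -, rfl⟩
    exact hy (F.map_source (hs ▸ mem_univ x))
  rw [extDerivForm_congr (signedPushforward_eventually_eq_zero oM oN hs hη hy'), extDerivForm_zero]


/-- Two regions cover `N`. On the image of the support the push-forward is locally a constant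
multiple of a smooth pull-back; off this image, which is compact and hence closed, it vanishes
locally. This is what makes the extension by zero smooth across the boundary of `F.target`. -/
theorem isTestForm_signedPushforward (hF : IsPartialDiffeo n F) (hs : F.source = univ)
    {η : DiffForm n M k} (hη : IsTestForm η) : IsTestForm (signedPushforward oM oN F η) := by
  have hK := isCompact_image_support hs hη
  refine ⟨fun ψ hψa z hz => ?_, hK.of_isClosed_subset isClosed_closure
    (closure_minimal (fun y hy => ?_) hK.isClosed)⟩
  · have hψ := isPartialDiffeo_of_mem_maximalAtlas hψa
    refine ContDiffAt.contDiffWithinAt ?_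
    by_cases hy : ψ.symm z ∈ F '' closure {x | η x ≠ 0}
    · obtain ⟨x, -, hxz⟩ := hy
      have hx : x ∈ F.source := hs ▸ mem_univ x
      have hzt : z ∈ (F.symm.symm ≫ₕ ψ).target := by
        rw [OpenPartialHomeomorph.trans_target]
        exact ⟨hz, by simpa [← hxz] using F.map_source hx⟩
      have h1 : ∀ᶠ y in 𝓝 (ψ.symm z), signedPushforward oM oN F η y =
          jacobianSign oM oN F x • pullback F.symm η y := by
        have h2 : ∀ᶠ y in 𝓝 (F x), jacobianSign oM oN F (F.symm y) = jacobianSign oM oN F x :=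
          F.tendsto_symm hx (jacobianSign_eventually_eq oM oN hF hx)
        rw [← hxz]
        filter_upwards [h2, F.open_target.mem_nhds (F.map_source hx)] with y hy hyt
        rw [signedPushforward, if_pos hyt, hy]
      have h3 : inChart ψ (signedPushforward oM oN F η) =ᶠ[𝓝 z]
          fun z' => jacobianSign oM oN F x • inChart (F.symm.symm ≫ₕ ψ) η z' := by
        filter_upwards [inChart_eventuallyEq hz h1,
          (F.symm.symm ≫ₕ ψ).open_target.mem_nhds hzt] with z' hz' hzt'
        rw [hz', inChart_symm_trans hF.symm hψ η hzt']
        rfl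
      have h4 := (hη.1 _ (hF.symm.symm_trans_mem_maximalAtlas hψa) z hzt).contDiffAt
        ((F.symm.symm ≫ₕ ψ).open_target.mem_nhds hzt)
      exact (h4.const_smul _).congr_of_eventuallyEq h3
    · have h1 : inChart ψ (signedPushforward oM oN F η) =ᶠ[𝓝 z] fun _ => 0 := by
        refine (inChart_eventuallyEq (η' := fun _ => 0) hz
          (signedPushforward_eventually_eq_zero oM oN hs hη hy)).trans (.of_forall fun z' => ?_)
        ext v
        rfl
      exact contDiffAt_const.congr_of_eventuallyEq h1
  · by_contra h
    exact hy (signedPushforward_eq_zero oM oN h)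

/-- Near `x` the sign is constant and squares to 1, so `η` is this constant times a pull-back; `d`
commutes with both operations. -/
theorem extDerivForm_eq_smul_pullback (hF : IsPartialDiffeo n F) (hs : F.source = univ)
    {η : DiffForm n M k} (hη : IsTestForm η) (x : M) :
    extDerivForm η x = jacobianSign oM oN F x •
      pullback F (extDerivForm (signedPushforward oM oN F η)) x := by
  have hx : x ∈ F.source := hs ▸ mem_univ x
  have h : ∀ᶠ y in 𝓝 x, η y = jacobianSign oM oN F x •
      pullback F (signedPushforward oM oN F η) y := by
    filter_upwards [jacobianSign_eventually_eq oM oN hF hx] with y hy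
    rw [← hy]
    exact eq_smul_pullback_signedPushforward oM oN hF η (hs ▸ mem_univ y)
  rw [extDerivForm_congr h, extDerivForm_const_smul,
    extDerivForm_pullback hF (isTestForm_signedPushforward oM oN hF hs hη).1 hx]

end PushForward

/-! ### Pull-back by a bilipschitz embedding -/

section Embedding

variable {n : ℕ}
  {M : Type*} [TopologicalSpace M] [SecondCountableTopology M]
  [ChartedSpace (EuclideanSpace ℝ (Fin n)) M] [IsManifold (𝓡 n) ∞ M]
  [MeasurableSpace M] [BorelSpace M] [RiemannianBundle (fun x : M => TangentSpace (𝓡 n) x)]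
  [IsContMDiffRiemannianBundle (𝓡 n) ∞ (EuclideanSpace ℝ (Fin n))
      (fun x : M => TangentSpace (𝓡 n) x)]
  {N : Type*} [TopologicalSpace N] [SecondCountableTopology N]
  [ChartedSpace (EuclideanSpace ℝ (Fin n)) N] [IsManifold (𝓡 n) ∞ N]
  [MeasurableSpace N] [BorelSpace N] [RiemannianBundle (fun x : N => TangentSpace (𝓡 n) x)]
  [IsContMDiffRiemannianBundle (𝓡 n) ∞ (EuclideanSpace ℝ (Fin n))
      (fun x : N => TangentSpace (𝓡 n) x)] {k : ℕ} {F : OpenPartialHomeomorph M N}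

/-- Since `g` vanishes off `F.target`, only the restricted measure matters, and that is the image of
the measure of `M` with density `jacobian`. As `F` is a measurable embedding, no regularity of `g`
is required. -/
theorem integral_jacobian_mul_comp (hF : IsPartialDiffeo n F) (hs : F.source = univ) {g : N → ℝ}
    (hg : ∀ y ∉ F.target, g y = 0) :
    ∫ x, jacobian (n := n) F x * g (F x) ∂riemannianMeasure n M =
      ∫ y, g y ∂riemannianMeasure n N := by
  have hFe := measurableEmbedding_of_isPartialDiffeo hs
  rw [← setIntegral_eq_integral_of_forall_compl_eq_zero hg,
    restrict_riemannianMeasure_target hF hs, hFe.integral_map,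
    integral_withDensity_eq_integral_toReal_smul
      (continuous_jacobian hF hs).measurable.ennreal_ofReal (.of_forall fun _ => by simp)]
  refine integral_congr_ae (.of_forall fun x => ?_)
  simp only [smul_eq_mul]
  rw [ENNReal.toReal_ofReal (jacobian_pos hF (hs ▸ mem_univ x)).le]

theorem integralForm_wedge_pullback (oM : ManifoldOrientation n M) (oN : ManifoldOrientation n N)
    (hF : IsPartialDiffeo n F) (hs : F.source = univ) {l : ℕ} (h : k + l = n)
    (α : DiffForm n N k) {β : DiffForm n N l} (hβ : ∀ y ∉ F.target, β y = 0) :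
    integralForm oM (fun x => wedge h (pullback F α x).toAlternatingMap
      (jacobianSign oM oN F x • pullback F β x).toAlternatingMap) =
    integralForm oN (fun y => wedge h (α y).toAlternatingMap (β y).toAlternatingMap) := by
  rw [integralForm, integralForm, ← integral_jacobian_mul_comp hF hs]
  · exact integral_congr_ae (.of_forall fun x => volCoeff_wedge_pullback oM oN h α β x)
  · intro y hy
    rw [hβ y hy]
    exact (congrArg (volCoeff (oN.orient y)) (wedge_zero_right h _)).trans (volCoeff_zero _)

variable {L : ℝ}

/-- The pointwise norm bound gives `L ^ k` and the binomial factor, the comparison of measures gives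
`L ^ (n / p)`. The set `U` is arbitrary so that the same estimate serves the local and the global
spaces. -/
theorem eLpNorm_pullback_le (hF : IsPartialDiffeo n F) (hs : F.source = univ) (hL : 0 < L)
    (hA : IsInfinitesimallyBilipschitz n L F) (p : ℝ≥0∞) (α : DiffForm n N k)
    (U : Set N) :
    eLpNorm (fun x => grassmannNorm (pullback F α x).toAlternatingMap) p
        ((riemannianMeasure n M).restrict (F ⁻¹' U)) ≤
      ENNReal.ofReal ((n.choose k : ℝ) ^ (1 / 2 : ℝ) * L ^ ((k : ℝ) + n / p.toReal)) *
        eLpNorm (fun y => grassmannNorm (α y).toAlternatingMap) p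
          ((riemannianMeasure n N).restrict U) := by
  have hFe := measurableEmbedding_of_isPartialDiffeo hs
  have h1 : ∀ x, ‖grassmannNorm (pullback F α x).toAlternatingMap‖ ≤ √(n.choose k) * L ^ k *
      ‖((fun y => grassmannNorm (α y).toAlternatingMap) ∘ F) x‖ := fun x => by
    rw [Real.norm_of_nonneg (grassmannNorm_nonneg _), Function.comp_apply,
      Real.norm_of_nonneg (grassmannNorm_nonneg _)]
    exact grassmannNorm_compLinearMap_le (fact_finrank_tangent (n := n) x).out hL.le
      (mfderiv (𝓡 n) (𝓡 n) F x).toLinearMap (fun v => (hA.2 x v).2) (α (F x)).toAlternatingMap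
  refine (eLpNorm_le_mul_eLpNorm_of_ae_le_mul (.of_forall h1) p).trans ?_
  have h2 : (riemannianMeasure n M).map F ≤ _ :=
    map_riemannianMeasure_le hF hs hL fun x v => (hA.2 x v).1
  rw [← hFe.eLpNorm_map_measure, ← hFe.restrict_map]
  refine (mul_le_mul_right (eLpNorm_mono_measure _ (Measure.restrict_mono_measure h2 U)) _).trans ?_
  have h3 : ENNReal.ofReal (L ^ n) ≠ 0 := by simp [hL]
  rw [Measure.restrict_smul, eLpNorm_smul_measure_of_ne_zero h3, smul_eq_mul, ← mul_assoc]
  refine le_of_eq (congrArg (· * _) ?_)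
  -- For `p = ∞` one has `p.toReal = 0`, and division by zero gives exactly the convention `n / ∞ =
  -- 0`.
  rw [ENNReal.ofReal_rpow_of_pos (by positivity), ← ENNReal.ofReal_mul (by positivity),
    ← Real.sqrt_eq_rpow, Real.rpow_add hL, Real.rpow_natCast, ← Real.rpow_natCast L n,
    ← Real.rpow_mul hL.le]
  simp [mul_assoc, div_eq_mul_inv]

theorem formNorm_pullback_le (hF : IsPartialDiffeo n F) (hs : F.source = univ) (hL : 0 < L)
    (hA : IsInfinitesimallyBilipschitz n L F) (p : ℝ≥0∞) (α : DiffForm n N k) :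
    formNorm p (pullback F α) ≤
      ENNReal.ofReal ((n.choose k : ℝ) ^ (1 / 2 : ℝ) * L ^ ((k : ℝ) + n / p.toReal)) *
        formNorm p α := by
  simpa [formNorm] using eLpNorm_pullback_le hF hs hL hA p α univ

theorem MemLpForm.pullback (hF : IsPartialDiffeo n F) (hs : F.source = univ) (hL : 0 < L)
    (hA : IsInfinitesimallyBilipschitz n L F) {p : ℝ≥0∞} {α : DiffForm n N k}
    (hα : MemLpForm p α) : MemLpForm p (pullback F α) :=
  ⟨hα.1.pullback hF hs, (formNorm_pullback_le hF hs hL hA p α).trans_lt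
    (ENNReal.mul_lt_top ENNReal.ofReal_lt_top hα.2)⟩

theorem MemLpLocForm.pullback (hF : IsPartialDiffeo n F) (hs : F.source = univ) (hL : 0 < L)
    (hA : IsInfinitesimallyBilipschitz n L F) {p : ℝ≥0∞} {α : DiffForm n N k}
    (hα : MemLpLocForm p α) : MemLpLocForm p (pullback F α) := by
  refine ⟨hα.1.pullback hF hs, fun x => ?_⟩
  obtain ⟨U, hU, hUp⟩ := hα.2 (F x)
  obtain ⟨V, hVU, hV, hxV⟩ := mem_nhds_iff.1 hU
  refine ⟨F ⁻¹' V, (F.continuousAt (hs ▸ mem_univ x)).preimage_mem_nhds (hV.mem_nhds hxV),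
    (eLpNorm_pullback_le hF hs hL hA p α V).trans_lt
      (ENNReal.mul_lt_top ENNReal.ofReal_lt_top (lt_of_le_of_lt ?_ hUp))⟩
  exact eLpNorm_mono_measure _ (Measure.restrict_mono hVU le_rfl)

/-- The image of the measure of `M` is dominated by a multiple of the measure of `N`, so preimages
of null sets are null. -/
theorem ae_pullback_eq (hF : IsPartialDiffeo n F) (hs : F.source = univ) (hL : 0 < L)
    (hA : IsInfinitesimallyBilipschitz n L F) {α β : DiffForm n N k}
    (h : ∀ᵐ y ∂(riemannianMeasure n N), α y = β y) :
    ∀ᵐ x ∂(riemannianMeasure n M), pullback F α x = pullback F β x := by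
  have hFe := measurableEmbedding_of_isPartialDiffeo hs
  have h1 : (riemannianMeasure n M).map F ≪ riemannianMeasure n N :=
    (Measure.absolutelyContinuous_of_le
      (map_riemannianMeasure_le hF hs hL fun x v => (hA.2 x v).1)).trans
        Measure.smul_absolutelyContinuous
  filter_upwards [ae_of_ae_map hFe.measurable.aemeasurable (h1.ae_le h)] with x hx
  exact pullback_congr_form hx

variable [T2Space N]

/-- The identity on `N` is applied to the signed push-forward of `η`. This form and its derivative
vanish off `F.target`, so both integrals can be moved to `M`, where they become those of `η` and
`dη`. -/
theorem IsWeakExtDeriv.pullback {oM : ManifoldOrientation n M} {oN : ManifoldOrientation n N}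
    (hF : IsPartialDiffeo n F) (hs : F.source = univ) (hL : 0 < L)
    (hA : IsInfinitesimallyBilipschitz n L F) {α : DiffForm n N k} {τ : DiffForm n N (k + 1)}
    (h : IsWeakExtDeriv oN α τ) : IsWeakExtDeriv oM (pullback F α) (pullback F τ) := by
  refine ⟨h.1.pullback hF hs hL hA, h.2.1.pullback hF hs hL hA, fun m hm hm' η hη => ?_⟩
  have h1 := h.2.2 m hm hm' _ (isTestForm_signedPushforward oM oN hF hs hη)
  rw [← integralForm_wedge_pullback oM oN hF hs hm α
      fun y hy => extDerivForm_signedPushforward_eq_zero oM oN hs hη hy,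
    ← integralForm_wedge_pullback oM oN hF hs hm' τ
      (β := signedPushforward oM oN F η) (fun y hy => if_neg hy)] at h1
  simp only [← extDerivForm_eq_smul_pullback oM oN hF hs hη,
    ← eq_smul_pullback_signedPushforward oM oN hF η (hs ▸ mem_univ _)] at h1
  exact h1

end Embedding

/-! ### The case of an empty source manifold. -/

section Empty

variable {n k : ℕ} {M : Type*} [TopologicalSpace M] [ChartedSpace (EuclideanSpace ℝ (Fin n)) M]
  [MeasurableSpace M] [RiemannianBundle (fun x : M => TangentSpace (𝓡 n) x)] [IsEmpty M]

theorem memLpForm_of_isEmpty (p : ℝ≥0∞) (α : DiffForm n M k) : MemLpForm p α := by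
  refine ⟨fun φ _ v => ?_, ?_⟩
  · have h : φ.target = ∅ := eq_empty_of_forall_notMem fun z _ => isEmptyElim (φ.symm z)
    simp [h]
  · simp [formNorm, Subsingleton.elim (riemannianMeasure n M) 0]

theorem memLpLocForm_of_isEmpty (p : ℝ≥0∞) (α : DiffForm n M k) : MemLpLocForm p α :=
  ⟨(memLpForm_of_isEmpty p α).1, isEmptyElim⟩

theorem isWeakExtDeriv_of_isEmpty (o : ManifoldOrientation n M) (α : DiffForm n M k)
    (τ : DiffForm n M (k + 1)) : IsWeakExtDeriv o α τ :=
  ⟨memLpLocForm_of_isEmpty 1 α, memLpLocForm_of_isEmpty 1 τ, fun _ _ _ _ _ => by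
    simp [integralForm, Subsingleton.elim (riemannianMeasure n M) 0]⟩

end Empty

end SobolevForms

end

theorem mainTheorem12 {n : ℕ}
    {M : Type*} [TopologicalSpace M] [T2Space M] [SecondCountableTopology M]
    [ChartedSpace (EuclideanSpace ℝ (Fin n)) M] [IsManifold (𝓡 n) ∞ M]
    [MeasurableSpace M] [BorelSpace M]
    [RiemannianBundle (fun x : M => TangentSpace (𝓡 n) x)]
    [IsContMDiffRiemannianBundle (𝓡 n) ∞ (EuclideanSpace ℝ (Fin n))
      (fun x : M => TangentSpace (𝓡 n) x)]
    {N : Type*} [TopologicalSpace N] [T2Space N] [SecondCountableTopology N]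
    [ChartedSpace (EuclideanSpace ℝ (Fin n)) N] [IsManifold (𝓡 n) ∞ N]
    [MeasurableSpace N] [BorelSpace N]
    [RiemannianBundle (fun y : N => TangentSpace (𝓡 n) y)]
    [IsContMDiffRiemannianBundle (𝓡 n) ∞ (EuclideanSpace ℝ (Fin n))
      (fun y : N => TangentSpace (𝓡 n) y)]
    (oM : ManifoldOrientation n M) (oN : ManifoldOrientation n N)
    (k : ℕ) (p q : ℝ≥0∞) (hp : 1 ≤ p) (hq : 1 ≤ q)
    (L : ℝ) (hL : 0 < L) (f : M → N) (hf : ContMDiff (𝓡 n) (𝓡 n) ∞ f)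
    (hfL : IsBilipschitz n L f ∨ IsInfinitesimallyBilipschitz n L f) :
    -- the pull-back is well defined on classes modulo equality almost everywhere
    (∀ (j : ℕ) (α β : DiffForm n N j), (∀ᵐ y ∂(riemannianMeasure n N), α y = β y) →
      ∀ᵐ x ∂(riemannianMeasure n M), pullback f α x = pullback f β x) ∧
    -- the local statement
    (∀ α : DiffForm n N k, MemWLoc oN p q α →
      MemWLoc oM p q (pullback f α) ∧
      ∀ τ : DiffForm n N (k + 1), IsWeakExtDeriv oN α τ →
        IsWeakExtDeriv oM (pullback f α) (pullback f τ)) ∧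
    -- the global statement with the norm estimates
    (∀ α : DiffForm n N k, MemW oN p q α →
      MemW oM p q (pullback f α) ∧
      formNorm p (pullback f α) ≤
        ENNReal.ofReal ((n.choose k : ℝ) ^ (1 / 2 : ℝ) * L ^ ((k : ℝ) + n / p.toReal)) *
          formNorm p α ∧
      ∀ τ : DiffForm n N (k + 1), IsWeakExtDeriv oN α τ →
        formNorm q (pullback f τ) ≤
          ENNReal.ofReal
            ((n.choose (k + 1) : ℝ) ^ (1 / 2 : ℝ) * L ^ ((k : ℝ) + 1 + n / q.toReal)) *
            formNorm q τ) := by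
  -- The inverse of the embedding as a globally defined function needs a point of `M`, so the empty
  -- case is separate; there the measure is zero.
  rcases isEmpty_or_nonempty M with hM | hM
  · have h0 : riemannianMeasure n M = 0 := Subsingleton.elim _ _
    refine ⟨fun j α β _ => by simp [h0], fun α _ => ⟨⟨memLpLocForm_of_isEmpty p _,
      pullback f 0, isWeakExtDeriv_of_isEmpty oM _ _, memLpLocForm_of_isEmpty q _⟩,
      fun τ _ => isWeakExtDeriv_of_isEmpty oM _ _⟩, fun α _ => ⟨⟨memLpForm_of_isEmpty p _,
      pullback f 0, isWeakExtDeriv_of_isEmpty oM _ _, memLpForm_of_isEmpty q _⟩, ?_,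
      fun τ _ => ?_⟩⟩ <;> simp [formNorm, h0]
  have hA : IsInfinitesimallyBilipschitz n L f :=
    hfL.elim (fun h => h.isInfinitesimallyBilipschitz hf hL) id
  have hinj : ∀ x, Function.Injective (mfderiv (𝓡 n) (𝓡 n) f x) := fun x => by
    refine (injective_iff_map_eq_zero (mfderiv (𝓡 n) (𝓡 n) f x)).2 fun v hv => ?_
    have h := (hA.2 x v).1
    rw [hv, norm_zero] at h
    exact norm_le_zero_iff.1 (nonpos_of_mul_nonpos_right h (inv_pos.2 hL))
  -- From here on `f` is the forward map of a diffeomorphism `F` onto an open set, so the pull-back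
  -- results for `F` apply.
  obtain ⟨F, hs, rfl, hF⟩ := exists_isPartialDiffeo hf hA.1 hinj
  refine ⟨fun j α β h => ae_pullback_eq hF hs hL hA h, ?_, ?_⟩
  · rintro α ⟨hα, τ, hτ, hτq⟩
    exact ⟨⟨hα.pullback hF hs hL hA, pullback F τ, hτ.pullback hF hs hL hA,
      hτq.pullback hF hs hL hA⟩, fun τ hτ => hτ.pullback hF hs hL hA⟩
  · rintro α ⟨hα, τ, hτ, hτq⟩
    refine ⟨⟨hα.pullback hF hs hL hA, pullback F τ, hτ.pullback hF hs hL hA,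
      hτq.pullback hF hs hL hA⟩, formNorm_pullback_le hF hs hL hA p α, fun τ _ => ?_⟩
    have h := formNorm_pullback_le hF hs hL hA q τ
    rwa [Nat.cast_add, Nat.cast_one] at h
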